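/- **Definitions.** Let $k\in\mathbb N=\{0,1,2,\dots\}$. A *topological $k$-graph* $(\Lambda,d)$ is a small category $\Lambda$ with range (codomain) and source (domain) maps $r,s:\operatorname{Mor}(\Lambda)\to\operatorname{Obj}(\Lambda)$ and a functor $d:\Lambda\to\mathbb N^k$ such that: $\operatorname{Obj}(\Lambda)$ and $\operatorname{Mor}(\Lambda)$ are second-countable locally compact Hausdorff spaces; $r,s$ are continuous and $s$ is a local homeomorphism; composition is a continuous open map from the space of composable pairs (with the subspace topology of the product) to $\operatorname{Mor}(\Lambda)$; $d$ is continuous for the discrete topology on $\mathbb N^k$; and whenever $d(\lambda)=m+n$ there is a unique composable pair $(\xi,\eta)$ with $\lambda=\xi\eta$, $d(\xi)=m$, $d(\eta)=n$. Write $\lambda\in\Lambda$ for $\lambda\in\operatorname{Mor}(\Lambda)$ and $\Lambda^m=d^{-1}(m)$. The graph is *compactly aligned* if for all $p,q\in\mathbb N^k$ and all compact $U\subset\Lambda^p$, $V\subset\Lambda^q$, the set $U\Lambda^{(p\vee q)-p}\cap V\Lambda^{(p\vee q)-q}$ is compact, where $p\vee q$ is the coordinatewise maximum. For $m\in(\mathbb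 N\cup\{\infty\})^k$ let $\Omega_{k,m}$ be the discrete topological $k$-graph with objects $\{p\in\mathbb N^k: p\le m\}$, morphisms $\{(p,q)\in\mathbb N^k\times\mathbb N^k:p\le q\le m\}$, $r(p,q)=p$, $s(p,q)=q$, $(n,p)(p,q)=(n,q)$, $d(p,q)=q-p$. The *path space* $X_\Lambda$ is the set of all continuous degree-preserving functors $x:\Omega_{k,m}\to\Lambda$, over all $m$; put $d(x)=m$ and $r(x)=x(0)$. For $n\in\mathbb N^k$ with $n\le d(x)$, $\sigma^n x$ is the path of degree $d(x)-n$ with $(\sigma^nx)(p,q)=x(n+p,n+q)$; for $\lambda\in\Lambda$ with $s(\lambda)=r(x)$, $\lambda x$ is the concatenated path, i.e. the unique path of degree $d(\lambda)+d(x)$ with $(\lambda x)(0,d(\lambda))=\lambda$ and $\sigma^{d(\lambda)}(\lambda x)=x$. The *path groupoid* $G_\Lambda$ has object set $X_\Lambda$ and morphisms the triples $(x,m,y)\in X_\Lambda\times\mathbb Z^k\times X_\Lambda$ for which there are $p,q\in\mathbb N^k$ with $p\le d(x)$, $q\le d(y)$, $p-q=m$ and $\sigma^px=\sigma^qy$ (equivalently,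 the triples $(\lambda z,d(\lambda)-d(\mu),\mu z)$ with $\lambda,\mu\in\Lambda$ and $z\in X_\Lambda$ such that $s(\lambda)=s(\mu)=r(z)$), with $r(x,m,y)=x$, $s(x,m,y)=y$, $(x,m,y)(y,n,z)=(x,m+n,z)$, $(x,m,y)^{-1}=(y,-m,x)$, and units $(x,0,x)$. Let $\Lambda*_s\Lambda=\{(\lambda,\mu):s(\lambda)=s(\mu)\}$ and $U*_sV=(U\times V)\cap(\Lambda*_s\Lambda)$. For $F\subset\Lambda*_s\Lambda$ and $m\in\mathbb Z^k$ put $$Z(F,m)=\{(\lambda z,d(\lambda)-d(\mu),\mu z):(\lambda,\mu)\in F,\ d(\lambda)-d(\mu)=m,\ z\in X_\Lambda,\ r(z)=s(\lambda)\}.$$ Give $G_\Lambda$ the topology generated by the sets $Z(U*_sV,m)\cap Z(F,m)^c$ with $m\in\mathbb Z^k$, $U,V\subset\Lambda$ open and $F\subset\Lambda*_s\Lambda$ compact. Give $X_\Lambda$ the topology of the unit space $G_\Lambda^{(0)}=\{(x,0,x):x\in X_\Lambda\}\subset G_\Lambda$ via $x\mapsto(x,0,x)$. **Theorem.** Let $(\Lambda,d)$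 be a compactly aligned topological $k$-graph. Then the sets $Z(U*_sV,m)\cap Z(F,m)^c$ form a basis of the topology of $G_\Lambda$, this topology is second-countable and Hausdorff, and $G_\Lambda$ is a locally compact $r$-discrete topological groupoid admitting a Haar system consisting of counting measures. That is: 1. $G_\Lambda$ is locally compact, and its range, source, inversion and composition maps are continuous; 2. the unit space $G_\Lambda^{(0)}$ is open in $G_\Lambda$; 3. the counting measures $\nu^x$ on the fibres $G_\Lambda^x=r^{-1}(x)$, regarded as Borel measures on $G_\Lambda$, form a Haar system: each $\nu^x$ is a Radon measure with support $G_\Lambda^x$; for every $f\in C_c(G_\Lambda)$ the function $x\mapsto\int f\,d\nu^x$ is continuous on $X_\Lambda$; and $\int f(gh)\,d\nu^{s(g)}(h)=\int f(h)\,d\nu^{r(g)}(h)$ for all $f\in C_c(G_\Lambda)$ and $g\in G_\Lambda$. -/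

import Mathlib

open MeasureTheory Topology

universe u v u' v'

namespace KGraph

/-- A small category, given by its set of objects, its set of morphisms, the range (codomain) and
source (domain) maps, identities, and composition of composable pairs.  The composite `f g` is
defined when `s f = r g`. -/
structure SmallCat where
  Obj : Type u
  Mor : Type v
  r : Mor → Obj
  s : Mor → Obj
  one : Obj → Mor
  comp : (f g : Mor) → s f = r g → Mor
  r_one : ∀ a, r (one a) = a
  s_one : ∀ a, s (one a) = a
  r_comp : ∀ f g h, r (comp f g h) = r f
  s_comp : ∀ f g h, s (comp f g h) = s g
  one_comp : ∀ f, comp (one (r f)) f (s_one (r f)) = f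
  comp_one : ∀ f, comp f (one (s f)) (r_one (s f)).symm = f
  assoc : ∀ f g h (hfg : s f = r g) (hgh : s g = r h),
    comp (comp f g hfg) h ((s_comp f g hfg).trans hgh) =
      comp f (comp g h hgh) (hfg.trans (r_comp g h hgh).symm)

/-- The set `C ×_c C` of composable pairs of morphisms. -/
def SmallCat.Composable (C : SmallCat.{u, v}) : Type v :=
  {p : C.Mor × C.Mor // C.s p.1 = C.r p.2}

instance (C : SmallCat.{u, v}) [TopologicalSpace C.Mor] : TopologicalSpace C.Composable :=
  inferInstanceAs (TopologicalSpace {p : C.Mor × C.Mor // C.s p.1 = C.r p.2})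

/-- Composition as a map on composable pairs. -/
def SmallCat.compMap (C : SmallCat.{u, v}) (p : C.Composable) : C.Mor :=
  C.comp p.1.1 p.1.2 p.2

/-- A topological `k`-graph: a small category `Λ` with topologies on objects and morphisms and a
degree functor `d` to the monoid `ℕ^k` with the unique factorization property. -/
structure TopKGraph (k : ℕ) extends SmallCat.{u, v} where
  [topObj : TopologicalSpace Obj]
  [topMor : TopologicalSpace Mor]
  [secondCountableObj : SecondCountableTopology Obj]
  [secondCountableMor : SecondCountableTopology Mor]
  [locallyCompactObj : LocallyCompactSpace Obj]
  [locallyCompactMor : LocallyCompactSpace Mor]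
  [t2Obj : T2Space Obj]
  [t2Mor : T2Space Mor]
  continuous_r : Continuous r
  continuous_s : Continuous s
  isLocalHomeomorph_s : IsLocalHomeomorph s
  continuous_comp : Continuous toSmallCat.compMap
  isOpenMap_comp : IsOpenMap toSmallCat.compMap
  d : Mor → Fin k → ℕ
  d_one : ∀ a, d (one a) = 0
  d_comp : ∀ f g h, d (comp f g h) = d f + d g
  continuous_d : Continuous d
  factorization : ∀ (f : Mor) (m n : Fin k → ℕ), d f = m + n →
    ∃! p : Mor × Mor, (∃ h : s p.1 = r p.2, comp p.1 p.2 h = f) ∧ d p.1 = m ∧ d p.2 = n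

attribute [instance] TopKGraph.topObj TopKGraph.topMor TopKGraph.secondCountableObj
  TopKGraph.secondCountableMor TopKGraph.locallyCompactObj TopKGraph.locallyCompactMor
  TopKGraph.t2Obj TopKGraph.t2Mor

variable {k : ℕ}

/-! ### Compact alignment -/

/-- The set `U W` of composites of a path in `U` and a path in `W`. -/
def TopKGraph.setComp (Λ : TopKGraph.{u, v} k) (U W : Set Λ.Mor) : Set Λ.Mor :=
  {f | ∃ ξ ∈ U, ∃ η ∈ W, ∃ h : Λ.s ξ = Λ.r η, Λ.comp ξ η h = f}

/-- The set `Λ^m` of paths of degree `m`. -/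
def TopKGraph.ofDegree (Λ : TopKGraph.{u, v} k) (m : Fin k → ℕ) : Set Λ.Mor := {f | Λ.d f = m}

/-- The set `U ∨ V = U Λ^{(p ∨ q) - p} ∩ V Λ^{(p ∨ q) - q}` of minimal common extensions, for
`U ⊆ Λ^p` and `V ⊆ Λ^q`. -/
def TopKGraph.minExt (Λ : TopKGraph.{u, v} k) (p q : Fin k → ℕ) (U V : Set Λ.Mor) : Set Λ.Mor :=
  Λ.setComp U (Λ.ofDegree (p ⊔ q - p)) ∩ Λ.setComp V (Λ.ofDegree (p ⊔ q - q))

/-- `Λ` is compactly aligned if `U ∨ V` is compact for all compact `U ⊆ Λ^p`, `V ⊆ Λ^q`. -/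
def TopKGraph.CompactlyAligned (Λ : TopKGraph.{u, v} k) : Prop :=
  ∀ (p q : Fin k → ℕ) (U V : Set Λ.Mor), U ⊆ Λ.ofDegree p → V ⊆ Λ.ofDegree q →
    IsCompact U → IsCompact V → IsCompact (Λ.minExt p q U V)

/-! ### Graph morphisms and the path prototypes -/

/-- A graph morphism: a continuous degree-preserving functor. -/
@[ext]
structure GraphMorphism (Λ₁ : TopKGraph.{u, v} k) (Λ₂ : TopKGraph.{u', v'} k) where
  obj : Λ₁.Obj → Λ₂.Obj
  mor : Λ₁.Mor → Λ₂.Mor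
  map_r : ∀ f, Λ₂.r (mor f) = obj (Λ₁.r f)
  map_s : ∀ f, Λ₂.s (mor f) = obj (Λ₁.s f)
  map_one : ∀ a, mor (Λ₁.one a) = Λ₂.one (obj a)
  map_comp : ∀ f g (h : Λ₁.s f = Λ₁.r g), mor (Λ₁.comp f g h) =
    Λ₂.comp (mor f) (mor g) ((map_s f).trans ((congrArg obj h).trans (map_r g).symm))
  map_d : ∀ f, Λ₂.d (mor f) = Λ₁.d f
  continuous_obj : Continuous obj
  continuous_mor : Continuous mor

/-- `p ≤ m` for `p ∈ ℕ^k` and `m ∈ (ℕ ∪ {∞})^k`. -/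
def Below (p : Fin k → ℕ) (m : Fin k → ℕ∞) : Prop := ∀ i, (p i : ℕ∞) ≤ m i

theorem Below.mono {p q : Fin k → ℕ} {m : Fin k → ℕ∞} (h : p ≤ q) (hq : Below q m) : Below p m :=
  fun i => le_trans (by exact_mod_cast h i) (hq i)

/-- The objects of `Ω_{k,m}`. -/
def OmegaObj (m : Fin k → ℕ∞) : Type := {p : Fin k → ℕ // Below p m}

/-- The morphisms `(p, q)`, `p ≤ q ≤ m`, of `Ω_{k,m}`. -/
def OmegaMor (m : Fin k → ℕ∞) : Type :=
  {p : (Fin k → ℕ) × (Fin k → ℕ) // p.1 ≤ p.2 ∧ Below p.2 m}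

/-- The small category underlying `Ω_{k,m}`; `(p, q)` has range `p` and source `q`. -/
def omegaCat (m : Fin k → ℕ∞) : SmallCat.{0, 0} where
  Obj := OmegaObj m
  Mor := OmegaMor m
  r f := ⟨f.1.1, f.2.2.mono f.2.1⟩
  s f := ⟨f.1.2, f.2.2⟩
  one a := ⟨(a.1, a.1), le_rfl, a.2⟩
  comp f g h := ⟨(f.1.1, g.1.2), f.2.1.trans ((congrArg Subtype.val h).le.trans g.2.1), g.2.2⟩
  r_one _ := rfl
  s_one _ := rfl
  r_comp _ _ _ := rfl
  s_comp _ _ _ := rfl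
  one_comp _ := rfl
  comp_one _ := rfl
  assoc _ _ _ _ _ := rfl

instance (m : Fin k → ℕ∞) : TopologicalSpace (omegaCat m).Obj := ⊥
instance (m : Fin k → ℕ∞) : TopologicalSpace (omegaCat m).Mor := ⊥
instance (m : Fin k → ℕ∞) : DiscreteTopology (omegaCat m).Obj := ⟨rfl⟩
instance (m : Fin k → ℕ∞) : DiscreteTopology (omegaCat m).Mor := ⟨rfl⟩
instance (m : Fin k → ℕ∞) : Countable (omegaCat m).Obj :=
  inferInstanceAs (Countable {p : Fin k → ℕ // Below p m})
instance (m : Fin k → ℕ∞) : Countable (omegaCat m).Mor :=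
  inferInstanceAs (Countable {p : (Fin k → ℕ) × (Fin k → ℕ) // p.1 ≤ p.2 ∧ Below p.2 m})

theorem isLocalHomeomorph_of_discrete {X Y : Type*} [TopologicalSpace X] [TopologicalSpace Y]
    [DiscreteTopology X] [DiscreteTopology Y] (f : X → Y) : IsLocalHomeomorph f := by
  rw [isLocalHomeomorph_iff_isOpenEmbedding_restrict]
  intro x
  refine ⟨{x}, by simp, ?_⟩
  refine .of_continuous_injective_isOpenMap continuous_of_discreteTopology ?_ ?_
  · intro a b _
    exact Subtype.ext (a.2.trans b.2.symm)
  · intro U _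
    exact isOpen_discrete _

instance (m : Fin k → ℕ∞) : DiscreteTopology (omegaCat m).Composable :=
  inferInstanceAs (DiscreteTopology
    {p : (omegaCat m).Mor × (omegaCat m).Mor // (omegaCat m).s p.1 = (omegaCat m).r p.2})

theorem omega_d_comp {m : Fin k → ℕ∞} (f g : OmegaMor m) (h : f.1.2 = g.1.1) :
    g.1.2 - f.1.1 = (f.1.2 - f.1.1) + (g.1.2 - g.1.1) := by
  funext i
  have h1 : f.1.1 i ≤ f.1.2 i := f.2.1 i
  have h2 : g.1.1 i ≤ g.1.2 i := g.2.1 i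
  have h3 := congrFun h i
  simp only [Pi.add_apply, Pi.sub_apply]
  omega

theorem omega_factorization {m : Fin k → ℕ∞} (f : (omegaCat m).Mor) (a b : Fin k → ℕ)
    (hab : f.1.2 - f.1.1 = a + b) :
    ∃! p : (omegaCat m).Mor × (omegaCat m).Mor,
      (∃ h : (omegaCat m).s p.1 = (omegaCat m).r p.2, (omegaCat m).comp p.1 p.2 h = f) ∧
        p.1.1.2 - p.1.1.1 = a ∧ p.2.1.2 - p.2.1.1 = b := by
  have hf : ∀ i, f.1.1 i ≤ f.1.2 i := f.2.1
  have hab' : ∀ i, f.1.2 i - f.1.1 i = a i + b i := fun i => congrFun hab i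
  have hle : f.1.1 + a ≤ f.1.2 := fun i => by
    have := hf i; have := hab' i; simp only [Pi.add_apply]; omega
  refine ⟨(⟨(f.1.1, f.1.1 + a), fun i => by simp, f.2.2.mono hle⟩,
    ⟨(f.1.1 + a, f.1.2), hle, f.2.2⟩), ⟨⟨rfl, rfl⟩, ?_, ?_⟩, ?_⟩
  · funext i; simp
  · funext i; have := hf i; have := hab' i; simp only [Pi.add_apply, Pi.sub_apply]; omega
  · rintro ⟨x, y⟩ ⟨⟨h, rfl⟩, hx, hy⟩
    have h' : x.1.2 = y.1.1 := congrArg Subtype.val h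
    have e3 : x.1.2 = x.1.1 + a := by
      funext i
      have hx' : x.1.2 i - x.1.1 i = a i := congrFun hx i
      have : x.1.1 i ≤ x.1.2 i := x.2.1 i
      simp only [Pi.add_apply]; omega
    exact Prod.ext (Subtype.ext (Prod.ext rfl e3)) (Subtype.ext (Prod.ext (h'.symm.trans e3) rfl))

/-- The discrete topological `k`-graph `Ω_{k,m}`, with degree map `d(p, q) = q - p`. -/
def Omega (m : Fin k → ℕ∞) : TopKGraph.{0, 0} k where
  __ := omegaCat m
  topObj := instTopologicalSpaceObjOmegaCat m
  topMor := instTopologicalSpaceMorOmegaCat m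
  secondCountableObj := inferInstanceAs (SecondCountableTopology (omegaCat m).Obj)
  secondCountableMor := inferInstanceAs (SecondCountableTopology (omegaCat m).Mor)
  locallyCompactObj := inferInstanceAs (LocallyCompactSpace (omegaCat m).Obj)
  locallyCompactMor := inferInstanceAs (LocallyCompactSpace (omegaCat m).Mor)
  t2Obj := inferInstanceAs (T2Space (omegaCat m).Obj)
  t2Mor := inferInstanceAs (T2Space (omegaCat m).Mor)
  continuous_r := continuous_of_discreteTopology (α := (omegaCat m).Mor)
  continuous_s := continuous_of_discreteTopology (α := (omegaCat m).Mor)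
  isLocalHomeomorph_s :=
    isLocalHomeomorph_of_discrete (X := (omegaCat m).Mor) (Y := (omegaCat m).Obj) _
  continuous_comp := continuous_of_discreteTopology (α := (omegaCat m).Composable)
  isOpenMap_comp := fun _ _ => isOpen_discrete (α := (omegaCat m).Mor) _
  d f := f.1.2 - f.1.1
  d_one a := tsub_self a.1
  d_comp f g h := omega_d_comp f g (congrArg Subtype.val h)
  continuous_d := continuous_of_discreteTopology (α := (omegaCat m).Mor)
  factorization := omega_factorization

/-! ### The path space -/

/-- The path space `X_Λ`: graph morphisms `Ω_{k,m} → Λ` for all `m ∈ (ℕ ∪ {∞})^k`. -/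
def PathSpace (Λ : TopKGraph.{u, v} k) : Type (max u v) :=
  Σ m : Fin k → ℕ∞, GraphMorphism (Omega m) Λ

namespace PathSpace

variable {Λ : TopKGraph.{u, v} k}

/-- The degree of a path. -/
def deg (x : PathSpace Λ) : Fin k → ℕ∞ := x.1

/-- The vertex `x(p)`. -/
def vertex (x : PathSpace Λ) (p : Fin k → ℕ) (hp : Below p x.deg) : Λ.Obj := x.2.obj ⟨p, hp⟩

/-- The segment `x(p, q)`. -/
def seg (x : PathSpace Λ) (p q : Fin k → ℕ) (hpq : p ≤ q) (hq : Below q x.deg) : Λ.Mor :=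
  x.2.mor ⟨(p, q), hpq, hq⟩

theorem below_zero (m : Fin k → ℕ∞) : Below 0 m := fun i => by simp

/-- The range `r(x) = x(0)`. -/
def r (x : PathSpace Λ) : Λ.Obj := x.vertex 0 (below_zero _)

theorem ext_seg {x y : PathSpace Λ} (hd : x.deg = y.deg)
    (h : ∀ p q hpq hq hq', x.seg p q hpq hq = y.seg p q hpq hq') : x = y := by
  obtain ⟨m, f⟩ := x
  obtain ⟨m', g⟩ := y
  obtain rfl : m = m' := hd
  have hmor : f.mor = g.mor := funext fun a => h a.1.1 a.1.2 a.2.1 a.2.2 a.2.2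
  have hobj : f.obj = g.obj := by
    funext a
    have h1 := f.map_r ((Omega m).one a)
    have h2 := g.map_r ((Omega m).one a)
    rw [(Omega m).r_one] at h1 h2
    rw [← h1, ← h2, hmor]
  exact congrArg (Sigma.mk m) (GraphMorphism.ext hobj hmor)

theorem below_shift {m : Fin k → ℕ∞} {n a : Fin k → ℕ} (hn : Below n m)
    (ha : Below a (fun i => m i - (n i : ℕ∞))) : Below (n + a) m := fun i => by
  have h1 := hn i
  have h2 := ha i
  simp only [Pi.add_apply, Nat.cast_add]
  calc (n i : ℕ∞) + a i ≤ n i + (m i - n i) := by gcongr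
    _ = m i := add_tsub_cancel_of_le h1

/-- The shifted path `σ^n x` for `n ≤ d(x)`: it has degree `d(x) - n` and
`(σ^n x)(p, q) = x(n + p, n + q)`. -/
def shift (n : Fin k → ℕ) (x : PathSpace Λ) (hn : Below n x.deg) : PathSpace Λ :=
  ⟨fun i => x.deg i - (n i : ℕ∞),
    { obj := fun a => x.vertex (n + a.1) (below_shift hn a.2)
      mor := fun f => x.seg (n + f.1.1) (n + f.1.2) (add_le_add le_rfl f.2.1)
        (below_shift hn f.2.2)
      map_r := fun f => x.2.map_r _
      map_s := fun f => x.2.map_s _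
      map_one := fun a => x.2.map_one ⟨n + a.1, below_shift hn a.2⟩
      map_comp := fun f g h => by
        have h' : f.1.2 = g.1.1 := congrArg Subtype.val h
        exact x.2.map_comp ⟨(n + f.1.1, n + f.1.2), add_le_add le_rfl f.2.1, below_shift hn f.2.2⟩
          ⟨(n + g.1.1, n + g.1.2), add_le_add le_rfl g.2.1, below_shift hn g.2.2⟩
          (Subtype.ext (by change n + f.1.2 = n + g.1.1; rw [h']))
      map_d := fun f => by
        refine (x.2.map_d _).trans ?_
        funext i
        change n i + f.1.2 i - (n i + f.1.1 i) = f.1.2 i - f.1.1 i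
        omega
      continuous_obj := continuous_of_discreteTopology (α := (omegaCat _).Obj)
      continuous_mor := continuous_of_discreteTopology (α := (omegaCat _).Mor) }⟩

theorem seg_congr (x : PathSpace Λ) {p q p' q' : Fin k → ℕ} (hp : p = p') (hq : q = q')
    (h1 : p ≤ q) (h2 : Below q x.deg) :
    x.seg p q h1 h2 = x.seg p' q' (hp ▸ hq ▸ h1) (hq ▸ h2) := by
  subst hp hq; rfl

theorem s_path_seg (x : PathSpace Λ) (p q : Fin k → ℕ) (hpq : p ≤ q) (hq : Below q x.deg) :
    Λ.s (x.seg p q hpq hq) = x.vertex q hq := x.2.map_s _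

theorem r_path_seg (x : PathSpace Λ) (p q : Fin k → ℕ) (hpq : p ≤ q) (hq : Below q x.deg) :
    Λ.r (x.seg p q hpq hq) = x.vertex p (hq.mono hpq) := x.2.map_r _

theorem path_seg_comp (x : PathSpace Λ) (p q t : Fin k → ℕ) (hpq : p ≤ q) (hqt : q ≤ t)
    (ht : Below t x.deg) : x.seg p t (hpq.trans hqt) ht =
      Λ.comp (x.seg p q hpq (ht.mono hqt)) (x.seg q t hqt ht)
        ((s_path_seg _ _ _ _ _).trans (r_path_seg _ _ _ _ _).symm) :=
  x.2.map_comp ⟨(p, q), hpq, ht.mono hqt⟩ ⟨(q, t), hqt, ht⟩ rfl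

theorem shift_shift (x : PathSpace Λ) (n a : Fin k → ℕ) (hn : Below n x.deg)
    (ha : Below a (shift n x hn).deg) (hna : Below (n + a) x.deg) :
    shift a (shift n x hn) ha = shift (n + a) x hna := by
  refine ext_seg ?_ ?_
  · funext i
    change x.deg i - (n i : ℕ∞) - (a i : ℕ∞) = x.deg i - ((n i + a i : ℕ) : ℕ∞)
    rw [Nat.cast_add, tsub_add_eq_tsub_tsub]
  · intro p q hpq hq hq'
    exact seg_congr x (add_assoc n a p).symm (add_assoc n a q).symm
      (add_le_add le_rfl (add_le_add le_rfl hpq)) (below_shift hn (below_shift ha hq))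

end PathSpace

/-! ### Segments of finite paths and concatenation -/

namespace TopKGraph

variable (Λ : TopKGraph.{u, v} k)

theorem exists_factor (f : Λ.Mor) (m : Fin k → ℕ) (hm : m ≤ Λ.d f) :
    ∃ p : Λ.Mor × Λ.Mor, (∃ h : Λ.s p.1 = Λ.r p.2, Λ.comp p.1 p.2 h = f) ∧
      Λ.d p.1 = m ∧ Λ.d p.2 = Λ.d f - m :=
  (Λ.factorization f m (Λ.d f - m) (add_tsub_cancel_of_le hm).symm).exists

/-- The initial segment `f(0, m)`. -/
noncomputable def head (f : Λ.Mor) (m : Fin k → ℕ) (hm : m ≤ Λ.d f) : Λ.Mor :=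
  (Λ.exists_factor f m hm).choose.1

/-- The final segment `f(m, d(f))`. -/
noncomputable def tail (f : Λ.Mor) (m : Fin k → ℕ) (hm : m ≤ Λ.d f) : Λ.Mor :=
  (Λ.exists_factor f m hm).choose.2

variable {Λ}

theorem s_head (f : Λ.Mor) (m : Fin k → ℕ) (hm : m ≤ Λ.d f) :
    Λ.s (Λ.head f m hm) = Λ.r (Λ.tail f m hm) := (Λ.exists_factor f m hm).choose_spec.1.choose

theorem head_comp_tail (f : Λ.Mor) (m : Fin k → ℕ) (hm : m ≤ Λ.d f) :
    Λ.comp (Λ.head f m hm) (Λ.tail f m hm) (s_head f m hm) = f :=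
  (Λ.exists_factor f m hm).choose_spec.1.choose_spec

theorem d_head (f : Λ.Mor) (m : Fin k → ℕ) (hm : m ≤ Λ.d f) : Λ.d (Λ.head f m hm) = m :=
  (Λ.exists_factor f m hm).choose_spec.2.1

theorem d_tail (f : Λ.Mor) (m : Fin k → ℕ) (hm : m ≤ Λ.d f) : Λ.d (Λ.tail f m hm) = Λ.d f - m :=
  (Λ.exists_factor f m hm).choose_spec.2.2

theorem factor_unique {a b a' b' : Λ.Mor} (h : Λ.s a = Λ.r b) (h' : Λ.s a' = Λ.r b')
    (hc : Λ.comp a b h = Λ.comp a' b' h') (hd : Λ.d a = Λ.d a') : a = a' ∧ b = b' := by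
  have hdd : Λ.d a + Λ.d b = Λ.d a' + Λ.d b' := by rw [← Λ.d_comp _ _ h, ← Λ.d_comp _ _ h', hc]
  have hb : Λ.d b = Λ.d b' := by rw [hd] at hdd; exact add_left_cancel hdd
  have := (Λ.factorization _ _ _ (Λ.d_comp a b h)).unique (y₁ := (a, b)) (y₂ := (a', b'))
    ⟨⟨h, rfl⟩, rfl, rfl⟩ ⟨⟨h', hc.symm⟩, hd.symm, hb.symm⟩
  exact ⟨congrArg Prod.fst this, congrArg Prod.snd this⟩

theorem eq_head_tail {a b f : Λ.Mor} (h : Λ.s a = Λ.r b) (hc : Λ.comp a b h = f)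
    (hm : Λ.d a ≤ Λ.d f) : Λ.head f (Λ.d a) hm = a ∧ Λ.tail f (Λ.d a) hm = b :=
  factor_unique (s_head _ _ _) h ((head_comp_tail _ _ _).trans hc.symm) (d_head _ _ _)

theorem eq_one_of_d_eq_zero {f : Λ.Mor} (h : Λ.d f = 0) : f = Λ.one (Λ.s f) := by
  have := factor_unique (Λ.s_one (Λ.r f)) (Λ.r_one (Λ.s f)).symm
    ((Λ.one_comp f).trans (Λ.comp_one f).symm) (by rw [h, Λ.d_one])
  exact this.2

theorem comp_congr {a b a' b' : Λ.Mor} (ha : a = a') (hb : b = b') (h : Λ.s a = Λ.r b)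
    (h' : Λ.s a' = Λ.r b') : Λ.comp a b h = Λ.comp a' b' h' := by
  subst ha hb; rfl

theorem head_comp (f g : Λ.Mor) (h : Λ.s f = Λ.r g) (m : Fin k → ℕ) (hm : m ≤ Λ.d f)
    (hm' : m ≤ Λ.d (Λ.comp f g h)) : Λ.head (Λ.comp f g h) m hm' = Λ.head f m hm := by
  have hs : Λ.s (Λ.tail f m hm) = Λ.r g := by
    rw [← h, ← Λ.s_comp _ _ (s_head f m hm), head_comp_tail]
  refine (factor_unique (s_head _ _ hm') ((s_head f m hm).trans (Λ.r_comp _ g hs).symm) ?_ ?_).1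
  · rw [head_comp_tail, ← Λ.assoc]
    exact comp_congr (head_comp_tail f m hm).symm rfl _ _
  · rw [d_head, d_head]

variable (Λ) in
/-- The segment `f(p, q)` of a path `f`, for `p ≤ q ≤ d(f)`. -/
noncomputable def seg (f : Λ.Mor) (p q : Fin k → ℕ) (hpq : p ≤ q) (hq : q ≤ Λ.d f) : Λ.Mor :=
  Λ.tail (Λ.head f q hq) p (hpq.trans (d_head f q hq).ge)

theorem seg_comp (f g : Λ.Mor) (h : Λ.s f = Λ.r g) (p q : Fin k → ℕ) (hpq : p ≤ q)
    (hq : q ≤ Λ.d f) (hq' : q ≤ Λ.d (Λ.comp f g h)) :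
    Λ.seg (Λ.comp f g h) p q hpq hq' = Λ.seg f p q hpq hq := by
  unfold seg
  congr 1
  exact head_comp f g h q hq hq'

theorem head_head (f : Λ.Mor) (p q : Fin k → ℕ) (hpq : p ≤ q) (hq : q ≤ Λ.d f)
    (hp : p ≤ Λ.d (Λ.head f q hq)) :
    Λ.head (Λ.head f q hq) p hp = Λ.head f p (hpq.trans hq) := by
  have key := head_comp (Λ.head f q hq) (Λ.tail f q hq) (s_head f q hq) p hp
    (by rw [head_comp_tail]; exact hpq.trans hq)
  rw [← key]
  congr 1
  exact head_comp_tail f q hq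

theorem d_seg (f : Λ.Mor) (p q : Fin k → ℕ) (hpq : p ≤ q) (hq : q ≤ Λ.d f) :
    Λ.d (Λ.seg f p q hpq hq) = q - p := by
  unfold seg; rw [d_tail, d_head]

theorem s_seg (f : Λ.Mor) (p q : Fin k → ℕ) (hpq : p ≤ q) (hq : q ≤ Λ.d f) :
    Λ.s (Λ.seg f p q hpq hq) = Λ.s (Λ.head f q hq) := by
  unfold seg
  rw [← Λ.s_comp _ _ (s_head (Λ.head f q hq) p (hpq.trans (d_head f q hq).ge)), head_comp_tail]

theorem r_seg (f : Λ.Mor) (p q : Fin k → ℕ) (hpq : p ≤ q) (hq : q ≤ Λ.d f) :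
    Λ.r (Λ.seg f p q hpq hq) = Λ.s (Λ.head f p (hpq.trans hq)) := by
  unfold seg
  rw [← s_head, head_head _ _ _ hpq]

theorem head_comp_seg (f : Λ.Mor) (p q : Fin k → ℕ) (hpq : p ≤ q) (hq : q ≤ Λ.d f) :
    Λ.comp (Λ.head f p (hpq.trans hq)) (Λ.seg f p q hpq hq) (r_seg f p q hpq hq).symm =
      Λ.head f q hq := by
  refine Eq.trans ?_ (head_comp_tail (Λ.head f q hq) p (hpq.trans (d_head f q hq).ge))
  exact comp_congr (head_head f p q hpq hq _).symm rfl _ _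

theorem seg_comp_seg (f : Λ.Mor) (p q t : Fin k → ℕ) (hpq : p ≤ q) (hqt : q ≤ t)
    (ht : t ≤ Λ.d f) (h : Λ.s (Λ.seg f p q hpq (hqt.trans ht)) = Λ.r (Λ.seg f q t hqt ht)) :
    Λ.comp (Λ.seg f p q hpq (hqt.trans ht)) (Λ.seg f q t hqt ht) h =
      Λ.seg f p t (hpq.trans hqt) ht := by
  refine (factor_unique (a := Λ.head f p (hpq.trans (hqt.trans ht)))
    (a' := Λ.head f p (hpq.trans (hqt.trans ht)))
    ((r_seg _ _ _ hpq (hqt.trans ht)).symm.trans (Λ.r_comp _ _ h).symm)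
    (r_seg _ _ _ (hpq.trans hqt) ht).symm ?_ rfl).2
  rw [head_comp_seg, ← Λ.assoc, ← head_comp_seg f q t hqt ht]
  exact comp_congr (head_comp_seg f p q hpq (hqt.trans ht)) rfl _ _

end TopKGraph

namespace PathSpace

open TopKGraph

variable {Λ : TopKGraph.{u, v} k}

theorem below_sub {a q : Fin k → ℕ} {m : Fin k → ℕ∞} (hq : Below q (fun i => (a i : ℕ∞) + m i)) :
    Below (q - a) m := fun i => by
  have h := hq i
  simp only [Pi.sub_apply, ENat.natCast_sub]
  exact tsub_le_iff_left.mpr h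

/-- The finite path `f x(0, (q - d(f)) ∨ 0)`, which has degree `q ∨ d(f)`. -/
def word (f : Λ.Mor) (x : PathSpace Λ) (h : Λ.s f = x.r) (q : Fin k → ℕ)
    (hq : Below q (fun i => (Λ.d f i : ℕ∞) + x.deg i)) : Λ.Mor :=
  Λ.comp f (x.seg 0 (q - Λ.d f) (fun _ => Nat.zero_le _) (below_sub hq))
    (h.trans (r_path_seg _ _ _ _ _).symm)

theorem d_path_seg (x : PathSpace Λ) (p q : Fin k → ℕ) (hpq : p ≤ q) (hq : Below q x.deg) :
    Λ.d (x.seg p q hpq hq) = q - p := x.2.map_d _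

theorem le_d_word (f : Λ.Mor) (x : PathSpace Λ) (h : Λ.s f = x.r) (q : Fin k → ℕ)
    (hq : Below q (fun i => (Λ.d f i : ℕ∞) + x.deg i)) : q ≤ Λ.d (word f x h q hq) := fun i => by
  unfold word
  rw [Λ.d_comp, d_path_seg]
  simp only [Pi.add_apply, Pi.sub_apply, Pi.zero_apply]
  omega

theorem word_comp (f : Λ.Mor) (x : PathSpace Λ) (h : Λ.s f = x.r) (q t : Fin k → ℕ) (hqt : q ≤ t)
    (ht : Below t (fun i => (Λ.d f i : ℕ∞) + x.deg i)) :
    ∃ (g : Λ.Mor) (hg : Λ.s (word f x h q (ht.mono hqt)) = Λ.r g),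
      word f x h t ht = Λ.comp (word f x h q (ht.mono hqt)) g hg := by
  have hle : q - Λ.d f ≤ t - Λ.d f := tsub_le_tsub_right hqt _
  have hs : Λ.s (word f x h q (ht.mono hqt)) =
      Λ.r (x.seg (q - Λ.d f) (t - Λ.d f) hle (below_sub ht)) := by
    unfold word
    rw [Λ.s_comp]
    exact (s_path_seg _ _ _ _ _).trans (r_path_seg _ _ _ _ _).symm
  refine ⟨_, hs, ?_⟩
  unfold word
  rw [Λ.assoc]
  exact comp_congr rfl (path_seg_comp x 0 (q - Λ.d f) (t - Λ.d f) (fun _ => Nat.zero_le _) hle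
    (below_sub ht)) _ _

theorem head_word (f : Λ.Mor) (x : PathSpace Λ) (h : Λ.s f = x.r) (p q t : Fin k → ℕ) (hpq : p ≤ q)
    (hqt : q ≤ t) (ht : Below t (fun i => (Λ.d f i : ℕ∞) + x.deg i)) :
    Λ.head (word f x h q (ht.mono hqt)) p (hpq.trans (le_d_word f x h q _)) =
      Λ.head (word f x h t ht) p (hpq.trans (hqt.trans (le_d_word f x h t ht))) := by
  obtain ⟨g, hg, e⟩ := word_comp f x h q t hqt ht
  rw [← head_comp _ g hg p _ (by rw [← e]; exact hpq.trans (hqt.trans (le_d_word f x h t ht)))]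
  congr 1
  exact e.symm

theorem seg_word (f : Λ.Mor) (x : PathSpace Λ) (h : Λ.s f = x.r) (p q t : Fin k → ℕ) (hpq : p ≤ q)
    (hqt : q ≤ t) (ht : Below t (fun i => (Λ.d f i : ℕ∞) + x.deg i)) :
    Λ.seg (word f x h q (ht.mono hqt)) p q hpq (le_d_word f x h q _) =
      Λ.seg (word f x h t ht) p q hpq (hqt.trans (le_d_word f x h t ht)) := by
  unfold TopKGraph.seg
  congr 1
  exact head_word f x h q q t le_rfl hqt ht

/-- The concatenation `f x`, for `s(f) = r(x)`: it has degree `d(f) + d(x)`, and `(f x)(p, q)` is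
the segment from `p` to `q` of the finite path `f x(0, (q - d(f)) ∨ 0)`. -/
noncomputable def concat (f : Λ.Mor) (x : PathSpace Λ) (h : Λ.s f = x.r) : PathSpace Λ :=
  ⟨fun i => (Λ.d f i : ℕ∞) + x.deg i,
    { obj := fun a => Λ.s (Λ.head (word f x h a.1 a.2) a.1 (le_d_word f x h a.1 a.2))
      mor := fun e => Λ.seg (word f x h e.1.2 e.2.2) e.1.1 e.1.2 e.2.1 (le_d_word f x h _ _)
      map_r := fun e => by
        rw [r_seg]
        exact congrArg Λ.s (head_word f x h e.1.1 e.1.1 e.1.2 le_rfl e.2.1 e.2.2).symm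
      map_s := fun e => s_seg _ _ _ _ _
      map_one := fun a => by
        have h0 := eq_one_of_d_eq_zero (f := Λ.seg (word f x h a.1 a.2) a.1 a.1 le_rfl
          (le_d_word f x h _ _)) (by rw [d_seg, tsub_self])
        rw [s_seg] at h0
        exact h0
      map_comp := fun e g hh => by
        obtain ⟨⟨p, q⟩, hpq, hq⟩ := e
        obtain ⟨⟨q', t⟩, hqt, ht⟩ := g
        obtain rfl : q = q' := congrArg Subtype.val hh
        refine Eq.trans (seg_comp_seg (word f x h t ht) p q t hpq hqt (le_d_word f x h t ht)
          ((s_seg _ _ _ _ _).trans (r_seg _ _ _ _ _).symm)).symm ?_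
        exact comp_congr (seg_word f x h p q t hpq hqt ht).symm rfl _ _
      map_d := fun e => d_seg _ _ _ _ _
      continuous_obj := continuous_of_discreteTopology (α := (omegaCat _).Obj)
      continuous_mor := continuous_of_discreteTopology (α := (omegaCat _).Mor) }⟩

theorem head_self (w : Λ.Mor) (q : Fin k → ℕ) (hq : q ≤ Λ.d w) (h : Λ.d w = q) :
    Λ.head w q hq = w := by
  subst h
  exact (eq_head_tail (Λ.r_one (Λ.s w)).symm (Λ.comp_one w) hq).1

theorem seg_eq_of_comp {A B w : Λ.Mor} (h : Λ.s A = Λ.r B) (hc : Λ.comp A B h = w)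
    {p q : Fin k → ℕ} (hA : Λ.d A = p) (hw : Λ.d w = q) (hpq : p ≤ q) (hq : q ≤ Λ.d w) :
    Λ.seg w p q hpq hq = B := by
  subst hA
  have e := head_self w q hq hw
  unfold TopKGraph.seg
  exact (eq_head_tail h (hc.trans e.symm) _).2

theorem below_d_concat (f : Λ.Mor) (x : PathSpace Λ) (h : Λ.s f = x.r) :
    Below (Λ.d f) (concat f x h).deg := fun _ => le_self_add

/-- `f` is the initial segment of `f x`. -/
theorem concat_seg_zero (f : Λ.Mor) (x : PathSpace Λ) (h : Λ.s f = x.r) :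
    (concat f x h).seg 0 (Λ.d f) (fun _ => Nat.zero_le _) (below_d_concat f x h) = f := by
  refine (seg_eq_of_comp (A := Λ.one (Λ.r f)) (Λ.s_one _) (Λ.one_comp f) (Λ.d_one _) rfl
    (fun _ => Nat.zero_le _) le_rfl).symm.trans ?_ |>.symm
  exact (seg_comp f _ _ 0 (Λ.d f) (fun _ => Nat.zero_le _) le_rfl _).symm

/-- Removing the initial segment `f` of `f x` gives `x`. -/
theorem shift_concat (f : Λ.Mor) (x : PathSpace Λ) (h : Λ.s f = x.r) :
    shift (Λ.d f) (concat f x h) (below_d_concat f x h) = x := by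
  refine ext_seg ?_ ?_
  · funext i
    exact (ENat.addLECancellable_natCast _).add_tsub_cancel_left
  · intro p q hpq hq hq'
    have hp' := hq'.mono hpq
    have h1 : Λ.s f = Λ.r (x.seg 0 p (fun _ => Nat.zero_le _) hp') :=
      h.trans (r_path_seg _ _ _ _ _).symm
    have h2 : Λ.s (Λ.comp f _ h1) = Λ.r (x.seg p q hpq hq') := by
      rw [Λ.s_comp, s_path_seg, r_path_seg]
    have h3 : Λ.s f = Λ.r (x.seg 0 q (fun _ => Nat.zero_le _) hq') :=
      h.trans (r_path_seg _ _ _ _ _).symm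
    have hB := below_shift (below_d_concat f x h) hq
    have e0 : word f x h (Λ.d f + q) hB = Λ.comp f _ h3 :=
      comp_congr rfl (seg_congr x rfl (add_tsub_cancel_left _ _) _ _) _ _
    have e1 : Λ.comp (Λ.comp f _ h1) _ h2 = word f x h (Λ.d f + q) hB := by
      rw [e0, Λ.assoc]
      · exact comp_congr rfl (path_seg_comp x 0 p q _ hpq hq').symm _ _
    refine seg_eq_of_comp h2 e1 ?_ ?_ (add_le_add le_rfl hpq) (le_d_word f x h _ hB)
    · rw [Λ.d_comp, d_path_seg, tsub_zero]
    · rw [e0, Λ.d_comp, d_path_seg, tsub_zero]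

/-- A path is the concatenation of its initial segment of degree `n` and its shift by `n`. -/
theorem concat_shift (x : PathSpace Λ) (n : Fin k → ℕ) (hn : Below n x.deg)
    (h : Λ.s (x.seg 0 n (fun _ => Nat.zero_le _) hn) = (shift n x hn).r) :
    concat (x.seg 0 n (fun _ => Nat.zero_le _) hn) (shift n x hn) h = x := by
  have hd : Λ.d (x.seg 0 n (fun _ => Nat.zero_le _) hn) = n := by rw [d_path_seg, tsub_zero]
  refine ext_seg ?_ ?_
  · funext i
    change ((Λ.d (x.seg 0 n _ hn) i : ℕ) : ℕ∞) + (x.deg i - (n i : ℕ∞)) = x.deg i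
    rw [hd]
    exact add_tsub_cancel_of_le (hn i)
  · intro p q hpq hq hq'
    generalize hf : x.seg 0 n (fun _ => Nat.zero_le _) hn = f at *
    have hle : n ≤ n + (q - Λ.d f) := le_self_add
    have hN : Below (n + (q - Λ.d f)) x.deg := below_shift hn (below_sub hq)
    have hqN : q ≤ n + (q - Λ.d f) := by rw [hd]; exact le_add_tsub
    have hw : word f (shift n x hn) h q hq = x.seg 0 (n + (q - Λ.d f)) (fun _ => Nat.zero_le _) hN := by
      rw [path_seg_comp x 0 n _ (fun _ => Nat.zero_le _) hle hN]
      exact comp_congr hf.symm (seg_congr x (add_zero n) rfl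
        (add_le_add le_rfl fun _ => Nat.zero_le _) hN) _ _
    have hw2 : Λ.comp (x.seg 0 q (fun _ => Nat.zero_le _) hq') (x.seg q _ hqN hN)
        ((s_path_seg _ _ _ _ _).trans (r_path_seg _ _ _ _ _).symm) =
        word f (shift n x hn) h q hq := by
      rw [hw, path_seg_comp x 0 q _ (fun _ => Nat.zero_le _) hqN hN]
    have key : ∀ (w : Λ.Mor) (hqw : q ≤ Λ.d w), Λ.comp (x.seg 0 q (fun _ => Nat.zero_le _) hq')
        (x.seg q _ hqN hN) ((s_path_seg _ _ _ _ _).trans (r_path_seg _ _ _ _ _).symm) = w →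
        Λ.seg w p q hpq hqw = x.seg p q hpq hq' := by
      rintro w hqw rfl
      have hdq : Λ.d (x.seg 0 q (fun _ => Nat.zero_le _) hq') = q := by rw [d_path_seg, tsub_zero]
      rw [seg_comp _ _ _ p q hpq hdq.ge]
      refine seg_eq_of_comp _ (path_seg_comp x 0 p q (fun _ => Nat.zero_le _) hpq hq').symm
        ?_ hdq _ _
      rw [d_path_seg, tsub_zero]
    exact key _ _ hw2

end PathSpace

/-! ### Topological groupoids and Haar systems -/

/-- A groupoid: a small category with inverses. -/
structure SmallGroupoid extends SmallCat.{u, v} where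
  inv : Mor → Mor
  r_inv : ∀ f, r (inv f) = s f
  s_inv : ∀ f, s (inv f) = r f
  inv_comp : ∀ f, comp (inv f) f (s_inv f) = one (s f)
  comp_inv : ∀ f, comp f (inv f) (r_inv f).symm = one (r f)

namespace SmallGroupoid

/-- `G` is a topological groupoid: inversion, composition, range and source are continuous, and
the object set carries the topology of the unit space as a subspace of `G`. -/
structure IsTopologicalGroupoid (G : SmallGroupoid.{u, v}) [TopologicalSpace G.Obj]
    [TopologicalSpace G.Mor] : Prop where
  isEmbedding_one : IsEmbedding G.one
  continuous_r : Continuous G.r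
  continuous_s : Continuous G.s
  continuous_inv : Continuous G.inv
  continuous_comp : Continuous G.compMap

/-- `G` is `r`-discrete: its unit space is open. -/
def IsRDiscrete (G : SmallGroupoid.{u, v}) [TopologicalSpace G.Mor] : Prop :=
  IsOpen (Set.range G.one)

/-- The fibre `G^a` of morphisms with range `a`. -/
def rFiber (G : SmallGroupoid.{u, v}) (a : G.Obj) : Set G.Mor := {g | G.r g = a}

open Classical in
/-- A (left) Haar system on `G`: a family of Radon measures `ν a` on `G`, with support `G^a`, such
that integrals of functions in `C_c(G)` depend continuously on `a`, and which is invariant under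
left translation. -/
structure IsHaarSystem (G : SmallGroupoid.{u, v}) [TopologicalSpace G.Obj]
    [TopologicalSpace G.Mor] [MeasurableSpace G.Mor] (ν : G.Obj → Measure G.Mor) : Prop where
  regular : ∀ a, (ν a).Regular
  support_eq : ∀ a, (ν a).support = G.rFiber a
  continuous_integral : ∀ f : G.Mor → ℂ, Continuous f → HasCompactSupport f →
    Continuous fun a => ∫ g, f g ∂(ν a)
  left_invariant : ∀ f : G.Mor → ℂ, Continuous f → HasCompactSupport f → ∀ g : G.Mor,
    ∫ h, (if e : G.s g = G.r h then f (G.comp g h e) else 0) ∂(ν (G.s g)) = ∫ h, f h ∂(ν (G.r g))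

end SmallGroupoid

/-! ### The path groupoid -/

namespace PathSpace

variable {Λ : TopKGraph.{u, v} k}

/-- There are `p ≤ d(x)` and `q ≤ d(y)` in `ℕ^k` with `p - q = m` and `σ^p x = σ^q y`. -/
def ShiftEquiv (x : PathSpace Λ) (m : Fin k → ℤ) (y : PathSpace Λ) : Prop :=
  ∃ (p q : Fin k → ℕ) (hp : Below p x.deg) (hq : Below q y.deg),
    (∀ i, (p i : ℤ) - (q i : ℤ) = m i) ∧ shift p x hp = shift q y hq

theorem ShiftEquiv.refl (x : PathSpace Λ) : ShiftEquiv x 0 x :=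
  ⟨0, 0, below_zero _, below_zero _, fun i => by simp, rfl⟩

theorem ShiftEquiv.symm {x y : PathSpace Λ} {m : Fin k → ℤ} (h : ShiftEquiv x m y) :
    ShiftEquiv y (-m) x := by
  obtain ⟨p, q, hp, hq, hm, e⟩ := h
  exact ⟨q, p, hq, hp, fun i => by rw [Pi.neg_apply, ← hm i]; ring, e.symm⟩

theorem below_add {m : Fin k → ℕ∞} {n a : Fin k → ℕ} (h : Below (n + a) m) :
    Below a (fun i => m i - (n i : ℕ∞)) := fun i => by
  have h1 := h i
  simp only [Pi.add_apply, Nat.cast_add] at h1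
  exact ENat.le_sub_of_add_le_left (ENat.natCast_ne_top _) h1

theorem extend_shift_eq {x y : PathSpace Λ} {p q : Fin k → ℕ} {hp : Below p x.deg}
    {hq : Below q y.deg} (e : shift p x hp = shift q y hq) (a : Fin k → ℕ)
    (hqa : Below (q + a) y.deg) :
    ∃ hpa : Below (p + a) x.deg, shift (p + a) x hpa = shift (q + a) y hqa := by
  have ha : Below a (shift q y hq).deg := below_add hqa
  have ha' : Below a (shift p x hp).deg := by rw [e]; exact ha
  refine ⟨below_shift hp ha', ?_⟩
  rw [← shift_shift x p a hp ha', ← shift_shift y q a hq ha]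
  congr 1

theorem ShiftEquiv.trans {x y z : PathSpace Λ} {m n : Fin k → ℤ} (h : ShiftEquiv x m y)
    (h' : ShiftEquiv y n z) : ShiftEquiv x (m + n) z := by
  obtain ⟨p, q, hp, hq, hm, e⟩ := h
  obtain ⟨p', q', hp', hq', hn, e'⟩ := h'
  have hN : Below (q ⊔ p') y.deg := fun i => by
    rcases le_total (q i) (p' i) with hh | hh
    · simpa [hh] using hp' i
    · simpa [hh] using hq i
  have e1 : q + (q ⊔ p' - q) = q ⊔ p' := add_tsub_cancel_of_le le_sup_left
  have e2 : p' + (q ⊔ p' - p') = q ⊔ p' := add_tsub_cancel_of_le le_sup_right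
  obtain ⟨h1, k1⟩ := extend_shift_eq e (q ⊔ p' - q) (by rw [e1]; exact hN)
  obtain ⟨h2, k2⟩ := extend_shift_eq e'.symm (q ⊔ p' - p') (by rw [e2]; exact hN)
  refine ⟨_, _, h1, h2, fun i => ?_, k1.trans (Eq.trans ?_ k2.symm)⟩
  · have := hm i; have := hn i
    have g1 := congrFun e1 i; have g2 := congrFun e2 i
    simp only [Pi.add_apply, Pi.sub_apply, Pi.sup_apply] at g1 g2 ⊢
    omega
  · congr 1
    rw [e1, e2]

/-- The triples `(x, m, y)` with `σ^p x = σ^q y`, `p - q = m`, are the triples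
`(f z, d(f) - d(g), g z)`. -/
theorem shiftEquiv_iff (x : PathSpace Λ) (m : Fin k → ℤ) (y : PathSpace Λ) :
    ShiftEquiv x m y ↔ ∃ (f g : Λ.Mor) (z : PathSpace Λ) (h₁ : Λ.s f = z.r) (h₂ : Λ.s g = z.r),
      (∀ i, (Λ.d f i : ℤ) - (Λ.d g i : ℤ) = m i) ∧ x = concat f z h₁ ∧ y = concat g z h₂ := by
  constructor
  · rintro ⟨p, q, hp, hq, hm, e⟩
    have r_shift : ∀ (w : PathSpace Λ) n hn, (shift n w hn).r = w.vertex n hn := by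
      intro w n hn
      change w.2.obj _ = w.2.obj _
      exact congrArg w.2.obj (Subtype.ext (add_zero n))
    have h₁ : Λ.s (x.seg 0 p (fun _ => Nat.zero_le _) hp) = (shift p x hp).r := by
      rw [s_path_seg, r_shift]
    have h₂ : Λ.s (y.seg 0 q (fun _ => Nat.zero_le _) hq) = (shift q y hq).r := by
      rw [s_path_seg, r_shift]
    refine ⟨_, _, shift p x hp, h₁, h₂.trans (congrArg r e.symm), fun i => ?_,
      (concat_shift x p hp h₁).symm, ?_⟩
    · rw [d_path_seg, d_path_seg]; simpa using hm i
    · simp only [e]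
      exact (concat_shift y q hq h₂).symm
  · rintro ⟨f, g, z, h₁, h₂, hm, rfl, rfl⟩
    exact ⟨_, _, below_d_concat _ _ _, below_d_concat _ _ _, hm,
      (shift_concat _ _ _).trans (shift_concat _ _ _).symm⟩

end PathSpace

/-- The path groupoid `G_Λ`: objects are the paths in `X_Λ`, morphisms the triples `(x, m, y)`. -/
def pathGroupoid (Λ : TopKGraph.{u, v} k) : SmallGroupoid.{max u v, max u v} where
  Obj := PathSpace Λ
  Mor := {g : PathSpace Λ × (Fin k → ℤ) × PathSpace Λ // PathSpace.ShiftEquiv g.1 g.2.1 g.2.2}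
  r g := g.1.1
  s g := g.1.2.2
  one x := ⟨(x, 0, x), .refl x⟩
  comp g h e := ⟨(g.1.1, g.1.2.1 + h.1.2.1, h.1.2.2), g.2.trans (by rw [e]; exact h.2)⟩
  r_one _ := rfl
  s_one _ := rfl
  r_comp _ _ _ := rfl
  s_comp _ _ _ := rfl
  one_comp g := Subtype.ext (by simp)
  comp_one g := Subtype.ext (by simp)
  assoc f g h _ _ := Subtype.ext (by simp [add_assoc])
  inv g := ⟨(g.1.2.2, -g.1.2.1, g.1.1), g.2.symm⟩
  r_inv _ := rfl
  s_inv _ := rfl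
  inv_comp g := Subtype.ext (by simp)
  comp_inv g := Subtype.ext (by simp)

variable (Λ : TopKGraph.{u, v} k)

/-- The set `U *_s V` of pairs in `U × V` with a common source. -/
def starS (U V : Set Λ.Mor) : Set (Λ.Mor × Λ.Mor) := {p | p.1 ∈ U ∧ p.2 ∈ V ∧ Λ.s p.1 = Λ.s p.2}

/-- The set `Z(F, m)` of all `(λ x, d(λ) - d(μ), μ x)` with `(λ, μ) ∈ F` and `d(λ) - d(μ) = m`. -/
def cylinder (F : Set (Λ.Mor × Λ.Mor)) (m : Fin k → ℤ) : Set (pathGroupoid Λ).Mor :=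
  {g | ∃ p ∈ F, ∃ (x : PathSpace Λ) (h₁ : Λ.s p.1 = x.r) (h₂ : Λ.s p.2 = x.r),
    (∀ i, (Λ.d p.1 i : ℤ) - (Λ.d p.2 i : ℤ) = m i) ∧
    g.1 = (PathSpace.concat p.1 x h₁, m, PathSpace.concat p.2 x h₂)}

/-- The family of sets `Z(U *_s V, m) ∩ Z(F, m)^c`, with `U, V ⊆ Λ` open and `F ⊆ Λ *_s Λ`
compact. -/
def basicSets : Set (Set (pathGroupoid Λ).Mor) :=
  {S | ∃ (m : Fin k → ℤ) (U V : Set Λ.Mor) (F : Set (Λ.Mor × Λ.Mor)),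
    IsOpen U ∧ IsOpen V ∧ F ⊆ starS Λ Set.univ Set.univ ∧ IsCompact F ∧
    S = cylinder Λ (starS Λ U V) m ∩ (cylinder Λ F m)ᶜ}

/-- The topology on `G_Λ` generated by the sets `Z(U *_s V, m) ∩ Z(F, m)^c`. -/
instance : TopologicalSpace (pathGroupoid Λ).Mor := TopologicalSpace.generateFrom (basicSets Λ)

/-- The object set `X_Λ` carries the topology of the unit space of `G_Λ`. -/
instance : TopologicalSpace (pathGroupoid Λ).Obj :=
  TopologicalSpace.induced (pathGroupoid Λ).one inferInstance

/-- `G_Λ` carries its Borel `σ`-algebra. -/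
instance : MeasurableSpace (pathGroupoid Λ).Mor := borel _

instance : BorelSpace (pathGroupoid Λ).Mor := ⟨rfl⟩

end KGraph

/-!
An element `g` of the path groupoid is determined by its degree and by the set of pairs `(a, b)`
with `g = (a z, m, b z)`. A basic open set prescribes that this set meets `U × V` and misses a
compact `F`, so the topology is the Fell topology on these closed sets: along an ultrafilter, `g`
converges to `g₀` exactly when the pairs representing `g₀` are the limits of pairs representing `g`.
Hausdorffness is then uniqueness of such limits, and continuity of the structure maps is a
statement about limits of pairs.

Compact alignment enters through joins: if prefixes of the same path converge to `a` and to `b`,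
then their least common extensions stay in a compact set and hence subconverge. So the limits of
prefixes form a directed set, which is the set of prefixes of a path, and cylinders over compact
sets are compact. Since `s` is a local homeomorphism, `(a z, m, b z)` can be recovered locally from
`a z`, so the range map of the groupoid is a local homeomorphism; for a groupoid with this property
`r`-discreteness and the Haar system of counting measures are general facts.
-/

namespace KGraph

open Filter

/-! ### Lower limits of sets -/

section LowerLimit

variable {X ι : Type*} [TopologicalSpace X] {l : Filter ι} {S : ι → Set X} {C O : Set X} {x : X}

/-- The Kuratowski lower limit of the sets `S i` along `l`: the points all of whose neighbourhoods
eventually meet `S i`. Convergence in `G_Λ` is expressed by it. -/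
def lowerLimit (l : Filter ι) (S : ι → Set X) : Set X :=
  {x | ∀ U ∈ 𝓝 x, ∀ᶠ i in l, (S i ∩ U).Nonempty}

theorem mem_of_mem_lowerLimit [l.NeBot] (hx : x ∈ lowerLimit l S) (hC : IsClosed C)
    (hS : ∀ᶠ i in l, S i ⊆ C) : x ∈ C := by
  by_contra hxC
  obtain ⟨i, hi, y, hyS, hyC⟩ := (hS.and (hx _ (hC.isOpen_compl.mem_nhds hxC))).exists
  exact hyC (hi hyS)

theorem lowerLimit_inter_subsingleton [l.NeBot] [T2Space X] (hO : IsOpen O)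
    (hS : ∀ᶠ i in l, (S i ∩ O).Subsingleton) : (lowerLimit l S ∩ O).Subsingleton := by
  rintro x ⟨hx, hxO⟩ y ⟨hy, hyO⟩
  by_contra hxy
  obtain ⟨U, V, hU, hV, hxU, hyV, hUV⟩ := t2_separation hxy
  obtain ⟨i, hi, ⟨x', hx', hxU', hxO'⟩, y', hy', hyV', hyO'⟩ := (hS.and
    ((hx _ ((hU.inter hO).mem_nhds ⟨hxU, hxO⟩)).and
      (hy _ ((hV.inter hO).mem_nhds ⟨hyV, hyO⟩)))).exists
  obtain rfl : x' = y' := hi ⟨hx', hxO'⟩ ⟨hy', hyO'⟩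
  exact Set.disjoint_left.1 hUV hxU' hyV'

theorem exists_mem_lowerLimit_of_isCompact {𝒰 : Ultrafilter ι} {K : Set X} (hK : IsCompact K)
    (hS : ∀ᶠ i in (𝒰 : Filter ι), (S i ∩ K).Nonempty) : ∃ x ∈ K, x ∈ lowerLimit 𝒰 S := by
  by_contra! hlim
  have hempty : ∀ᶠ i in (𝒰 : Filter ι), S i ∩ K = ∅ := by
    refine hK.induction_on (p := fun T => ∀ᶠ i in (𝒰 : Filter ι), S i ∩ T = ∅) ?_ ?_ ?_ ?_
    · exact .of_forall fun i => Set.inter_empty _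
    · exact fun T T' hT h => h.mono fun i hi =>
        Set.subset_eq_empty (Set.inter_subset_inter_right _ hT) hi
    · intro T T' h h'
      filter_upwards [h, h'] with i hi hi'
      rw [Set.inter_union_distrib_left, hi, hi', Set.union_empty]
    · intro x hx
      have hx' : ¬ ∀ U ∈ 𝓝 x, ∀ᶠ i in (𝒰 : Filter ι), (S i ∩ U).Nonempty := hlim x hx
      push Not at hx'
      obtain ⟨U, hU, hUS⟩ := hx'
      exact ⟨U, mem_nhdsWithin_of_mem_nhds hU, hUS⟩
  obtain ⟨i, hne, he⟩ := (hS.and hempty).exists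
  exact hne.ne_empty he

theorem isClosed_of_exists_subsingleton_inter [T1Space X]
    (hC : ∀ x, ∃ U ∈ 𝓝 x, (C ∩ U).Subsingleton) : IsClosed C := by
  refine isOpen_compl_iff.1 (isOpen_iff_mem_nhds.2 fun x hx => ?_)
  obtain ⟨U, hU, hCU⟩ := hC x
  filter_upwards [hU, hCU.isClosed.isOpen_compl.mem_nhds fun h => hx h.1] with y hyU hy hyC
  exact hy ⟨hyC, hyU⟩

end LowerLimit

/-! ### Sums over the fibres of a local homeomorphism -/

section Fibres

variable {G X : Type*} [TopologicalSpace G] [TopologicalSpace X] {r : G → X}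

theorem finite_inter_fiber [T1Space X] (hr : IsLocalHomeomorph r) {K : Set G} (hK : IsCompact K)
    (x : X) : (K ∩ r ⁻¹' {x}).Finite := by
  have himage : (r '' (K ∩ r ⁻¹' {x})).Subsingleton :=
    Set.subsingleton_singleton.anti (Set.image_subset_iff.2 Set.inter_subset_right)
  exact (hK.inter_right (isClosed_singleton.preimage hr.continuous)).finite
    (hr.isLocalHomeomorphOn.isDiscrete_of_image himage.isDiscrete)

theorem exists_local_section (hr : IsLocalHomeomorph r) (g : G) :
    ∃ σ : X → G, ContinuousAt σ (r g) ∧ (∀ᶠ x in 𝓝 (r g), r (σ x) = x) ∧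
      ∀ᶠ h in 𝓝 g, σ (r h) = h := by
  obtain ⟨φ, hg, rfl⟩ := hr g
  exact ⟨φ.symm, φ.continuousAt_symm (φ.map_source hg),
    φ.eventually_right_inverse (φ.map_source hg), φ.eventually_left_inverse hg⟩

theorem eventually_forall_fiber [T2Space X] (hr : Continuous r) {K : Set G} (hK : IsCompact K)
    {x₀ : X} {p : G → Prop} (hp : ∀ g ∈ K, r g = x₀ → ∀ᶠ h in 𝓝 g, p h) :
    ∀ᶠ x in 𝓝 x₀, ∀ g ∈ K, r g = x → p g := by
  refine hK.eventually_forall_of_forall_eventually fun g hg => ?_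
  by_cases hgx : r g = x₀
  · filter_upwards [continuous_snd.continuousAt.eventually (hp g hg hgx)] with q hq _
    exact hq
  · have hne : ∀ᶠ q : X × G in 𝓝 (x₀, g), r q.2 ≠ q.1 :=
      ((hr.comp continuous_snd).continuousAt.ne_iff_eventually_ne continuous_fst.continuousAt).1 hgx
    filter_upwards [hne] with q hq hqx
    exact absurd hqx hq

theorem exists_finset_local_sections [T2Space G] [T2Space X] (hr : IsLocalHomeomorph r) {K : Set G}
    (hK : IsCompact K) (x₀ : X) :
    ∃ (T : Finset G) (σ : G → X → G), (∀ g ∈ T, ContinuousAt (σ g) x₀) ∧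
      ∀ᶠ x in 𝓝 x₀, Set.InjOn (fun g => σ g x) T ∧ (∀ g ∈ T, r (σ g x) = x) ∧
        ∀ h ∈ K, r h = x → ∃ g ∈ T, σ g x = h := by
  choose σ hσ hrσ hσr using exists_local_section hr
  have hfin := finite_inter_fiber hr hK x₀
  have mem_T {g : G} : g ∈ hfin.toFinset ↔ g ∈ K ∧ r g = x₀ := hfin.mem_toFinset
  have hσx₀ : ∀ g ∈ hfin.toFinset, ContinuousAt (σ g) x₀ ∧ σ g x₀ = g := fun g hg => by
    obtain ⟨-, rfl⟩ := mem_T.1 hg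
    exact ⟨hσ g, (hσr g).self_of_nhds⟩
  refine ⟨hfin.toFinset, σ, fun g hg => (hσx₀ g hg).1, .and ?_ (.and ?_ ?_)⟩
  · have hne : ∀ g ∈ hfin.toFinset, ∀ g' ∈ hfin.toFinset,
        ∀ᶠ x in 𝓝 x₀, σ g x = σ g' x → g = g' := fun g hg g' hg' => by
      rcases eq_or_ne g g' with hgg' | hgg'
      · exact .of_forall fun _ _ => hgg'
      · have hne := ((hσx₀ g hg).1.ne_iff_eventually_ne (hσx₀ g' hg').1).1
          (by rwa [(hσx₀ g hg).2, (hσx₀ g' hg').2])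
        exact hne.mono fun x hx h => absurd h hx
    filter_upwards [(eventually_all_finset _).2 fun g hg => (eventually_all_finset _).2 (hne g hg)]
      with x hx g hg g' hg' h using hx g hg g' hg' h
  · refine (eventually_all_finset _).2 fun g hg => ?_
    obtain ⟨-, rfl⟩ := mem_T.1 hg
    exact hrσ g
  · have hcover := eventually_forall_fiber (p := fun h => ∃ g ∈ hfin.toFinset, σ g (r h) = h)
      hr.continuous hK fun g hg hgx => (hσr g).mono fun h hh => ⟨g, mem_T.2 ⟨hg, hgx⟩, hh⟩
    filter_upwards [hcover] with x hx h hh hhx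
    exact hhx ▸ hx h hh hhx

theorem continuous_finsum_fiber [T2Space G] [T2Space X] {E : Type*} [AddCommMonoid E]
    [TopologicalSpace E] [ContinuousAdd E] (hr : IsLocalHomeomorph r) {f : G → E}
    (hf : Continuous f) (hfc : HasCompactSupport f) :
    Continuous fun x => ∑ᶠ g ∈ r ⁻¹' {x}, f g := by
  refine continuous_iff_continuousAt.2 fun x₀ => ?_
  obtain ⟨T, σ, hσ, hfiber⟩ := exists_finset_local_sections hr hfc.isCompact x₀
  have hsum : (fun x => ∑ g ∈ T, f (σ g x)) =ᶠ[𝓝 x₀] fun x => ∑ᶠ g ∈ r ⁻¹' {x}, f g := by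
    filter_upwards [hfiber] with x ⟨hinj, hσx, hcover⟩
    rw [← finsum_mem_coe_finset, ← finsum_mem_image hinj]
    refine finsum_mem_inter_support_eq' _ _ _ fun h hh => ⟨?_, hcover h (subset_tsupport f hh)⟩
    rintro ⟨g, hg, rfl⟩
    exact hσx g hg
  have hcont : ContinuousAt (fun x => ∑ g ∈ T, f (σ g x)) x₀ :=
    tendsto_finsetSum _ fun g hg => hf.continuousAt.comp (hσ g hg)
  exact hcont.congr hsum

end Fibres

/-! ### Counting measure on a fibre -/

section CountRestrict

variable {X : Type*} [MeasurableSpace X]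

theorem integral_count_restrict_eq_finsum [MeasurableSingletonClass X] {E : Type*}
    [NormedAddCommGroup E] [NormedSpace ℝ E] [CompleteSpace E] {S : Set X} (hS : MeasurableSet S)
    {f : X → E} (hf : (S ∩ Function.support f).Finite) :
    ∫ x, f x ∂(Measure.count.restrict S) = ∑ᶠ x ∈ S, f x := by
  have hvanish : ∀ x ∈ S \ (S ∩ Function.support f), f x = 0 := fun x hx =>
    of_not_not fun hne => hx.2 ⟨hx.1, hne⟩
  have hint : IntegrableOn f hf.toFinset Measure.count := by
    rw [← Set.biUnion_of_singleton (hf.toFinset : Set X)]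
    exact integrableOn_finset_iUnion.2 fun x _ =>
      integrableOn_singleton (hx := Measure.count_apply_lt_top.2 (Set.finite_singleton x))
  calc ∫ x in S, f x ∂Measure.count
      = ∫ x in S ∩ Function.support f, f x ∂Measure.count :=
        setIntegral_eq_of_subset_of_forall_sdiff_eq_zero hS Set.inter_subset_left hvanish
    _ = ∫ x in (hf.toFinset : Set X), f x ∂Measure.count := by rw [hf.coe_toFinset]
    _ = ∑ x ∈ hf.toFinset, f x := by
        simp only [setIntegral_finset _ hint, count_real_singleton, one_smul]
    _ = ∑ᶠ x ∈ S, f x := by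
        rw [← finsum_mem_inter_support, finsum_mem_eq_finite_toFinset_sum _ hf]

variable [TopologicalSpace X] [T1Space X] [OpensMeasurableSpace X] {S : Set X}

theorem support_count_restrict (hS : IsClosed S) : (Measure.count.restrict S).support = S := by
  refine subset_antisymm ?_ fun x hx => (Measure.mem_support_iff_forall x).2 fun U hU => ?_
  · exact (Measure.support_restrict_subset.trans Set.inter_subset_left).trans hS.closure_eq.subset
  · calc 0 < Measure.count ({x} : Set X) := by simp
      _ = Measure.count.restrict S {x} := by
        rw [Measure.restrict_apply (measurableSet_singleton x),
          Set.inter_eq_left.2 (Set.singleton_subset_iff.2 hx)]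
      _ ≤ Measure.count.restrict S U :=
        measure_mono (Set.singleton_subset_iff.2 (mem_of_mem_nhds hU))

theorem isLocallyFiniteMeasure_count_restrict_fiber {Y : Type*} {r : X → Y}
    (hr : IsLocallyInjective r) (y : Y) :
    IsLocallyFiniteMeasure (Measure.count.restrict (r ⁻¹' {y})) := by
  refine ⟨fun x => ?_⟩
  obtain ⟨U, hU, hxU, hinj⟩ := hr x
  have hsub : (U ∩ r ⁻¹' {y}).Subsingleton := fun a ⟨ha, hay⟩ b ⟨hb, hby⟩ =>
    hinj ha hb (Eq.trans hay (Eq.symm hby))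
  refine ⟨U, hU.mem_nhds hxU, ?_⟩
  rw [Measure.restrict_apply hU.measurableSet]
  exact Measure.count_apply_lt_top.2 hsub.finite

end CountRestrict

/-! ### Groupoids whose range map is a local homeomorphism -/

namespace SmallGroupoid

variable {G : SmallGroupoid.{u, v}} {g h o : G.Mor}

theorem comp_eq_right (e : G.s o = G.r h) (ho : o = G.one (G.r h)) : G.comp o h e = h := by
  subst ho
  exact G.one_comp h

theorem inv_comp_cancel (e : G.s g = G.r h) :
    G.comp (G.inv g) (G.comp g h e) ((G.s_inv g).trans (G.r_comp g h e).symm) = h := by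
  rw [← G.assoc (G.inv g) g h (G.s_inv g) e]
  exact comp_eq_right _ ((G.inv_comp g).trans (congrArg G.one e))

theorem comp_inv_cancel (e : G.s (G.inv g) = G.r h) :
    G.comp g (G.comp (G.inv g) h e) ((G.r_inv g).symm.trans (G.r_comp _ h e).symm) = h := by
  rw [← G.assoc g (G.inv g) h (G.r_inv g).symm e]
  exact comp_eq_right _ ((G.comp_inv g).trans (congrArg G.one ((G.s_inv g).symm.trans e)))

/-- Left translation by `g`, as a bijection of the fibre over `s g` with the fibre over `r g`. -/
def leftTranslation (g : G.Mor) : G.rFiber (G.s g) ≃ G.rFiber (G.r g) where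
  toFun h := ⟨G.comp g h h.2.symm, G.r_comp _ _ _⟩
  invFun h := ⟨G.comp (G.inv g) h ((G.s_inv g).trans h.2.symm), (G.r_comp _ _ _).trans (G.r_inv g)⟩
  left_inv h := Subtype.ext (inv_comp_cancel h.2.symm)
  right_inv h := Subtype.ext (comp_inv_cancel ((G.s_inv g).trans h.2.symm))

open Classical in
theorem integral_leftTranslation [MeasurableSpace G.Mor] [MeasurableSingletonClass G.Mor]
    {E : Type*} [NormedAddCommGroup E] [NormedSpace ℝ E] [CompleteSpace E] (g : G.Mor)
    (hmeas : ∀ x, MeasurableSet (G.rFiber x)) {f : G.Mor → E}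
    (hf : (G.rFiber (G.r g) ∩ Function.support f).Finite) :
    ∫ h, (if e : G.s g = G.r h then f (G.comp g h e) else 0)
        ∂(Measure.count.restrict (G.rFiber (G.s g))) =
      ∫ h, f h ∂(Measure.count.restrict (G.rFiber (G.r g))) := by
  set F : G.Mor → E := fun h => if e : G.s g = G.r h then f (G.comp g h e) else 0
  have hF (h : G.rFiber (G.s g)) : F h = f (leftTranslation g h) := dif_pos h.2.symm
  have hFfin : (G.rFiber (G.s g) ∩ Function.support F).Finite := by
    have hpre : (Function.support fun h : G.rFiber (G.s g) => F h).Finite := by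
      simp only [hF]
      exact (hf.preimage (f := fun h => (leftTranslation g h : G.Mor))
        (Subtype.val_injective.comp (leftTranslation g).injective).injOn).subset
          fun h hh => ⟨(leftTranslation g h).2, hh⟩
    exact (hpre.image Subtype.val).subset fun h hh => ⟨⟨h, hh.1⟩, hh.2, rfl⟩
  calc ∫ h, F h ∂(Measure.count.restrict (G.rFiber (G.s g)))
      = ∑ᶠ h : G.rFiber (G.s g), F h := by
        rw [integral_count_restrict_eq_finsum (hmeas _) hFfin, finsum_set_coe_eq_finsum_mem]
    _ = ∑ᶠ h : G.rFiber (G.s g), f (leftTranslation g h) := finsum_congr hF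
    _ = ∑ᶠ h : G.rFiber (G.r g), f h :=
        finsum_comp_equiv (leftTranslation g) (f := fun h => f h)
    _ = ∫ h, f h ∂(Measure.count.restrict (G.rFiber (G.r g))) := by
        rw [integral_count_restrict_eq_finsum (hmeas _) hf, finsum_set_coe_eq_finsum_mem]

variable [TopologicalSpace G.Obj] [TopologicalSpace G.Mor]

theorem IsTopologicalGroupoid.isRDiscrete (hG : G.IsTopologicalGroupoid)
    (hr : IsLocallyInjective G.r) : G.IsRDiscrete := by
  refine isOpen_iff_mem_nhds.2 ?_
  rintro _ ⟨x, rfl⟩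
  obtain ⟨U, hU, hxU, hinj⟩ := hr (G.one x)
  have hcont : Continuous fun g => G.one (G.r g) :=
    hG.isEmbedding_one.continuous.comp hG.continuous_r
  have hone : ∀ᶠ g in 𝓝 (G.one x), G.one (G.r g) ∈ U :=
    hcont.continuousAt.eventually_mem (hU.mem_nhds (by rwa [G.r_one]))
  filter_upwards [hU.mem_nhds hxU, hone] with g hg hrg
  exact ⟨G.r g, hinj hrg hg (G.r_one _)⟩

theorem IsTopologicalGroupoid.isHaarSystem_count_restrict (hG : G.IsTopologicalGroupoid)
    (hr : IsLocalHomeomorph G.r) [T2Space G.Mor] [LocallyCompactSpace G.Mor]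
    [SecondCountableTopology G.Mor] [MeasurableSpace G.Mor] [BorelSpace G.Mor] :
    G.IsHaarSystem fun x => Measure.count.restrict (G.rFiber x) := by
  have : T2Space G.Obj := hG.isEmbedding_one.t2Space
  have hclosed (x : G.Obj) : IsClosed (G.rFiber x) := isClosed_singleton.preimage hG.continuous_r
  have hfin {f : G.Mor → ℂ} (hf : HasCompactSupport f) (x : G.Obj) :
      (G.rFiber x ∩ Function.support f).Finite := by
    rw [Set.inter_comm]
    exact (finite_inter_fiber hr hf x).subset
      (Set.inter_subset_inter_left _ (subset_tsupport f))
  refine ⟨fun x => ?_, fun x => support_count_restrict (hclosed x), fun f hf hfc => ?_,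
    fun f _ hfc g => integral_leftTranslation g (fun x => (hclosed x).measurableSet) (hfin hfc _)⟩
  · have : IsLocallyFiniteMeasure (Measure.count.restrict (G.rFiber x)) :=
      isLocallyFiniteMeasure_count_restrict_fiber hr.isLocallyInjective x
    infer_instance
  · exact (continuous_finsum_fiber hr hf hfc).congr fun x =>
      (integral_count_restrict_eq_finsum (hclosed x).measurableSet (hfin hfc x)).symm

end SmallGroupoid

variable {k : ℕ} {Λ : TopKGraph.{u, v} k}

theorem Below.sup {p q : Fin k → ℕ} {m : Fin k → ℕ∞} (hp : Below p m) (hq : Below q m) :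
    Below (p ⊔ q) m := fun i => by
  rcases le_total (p i) (q i) with h | h
  · simpa [h] using hq i
  · simpa [h] using hp i

namespace TopKGraph

/-- The relation `c = a b`. Being relational, it carries no proof that `a` and `b` are
composable. -/
def IsComp (a b c : Λ.Mor) : Prop := ∃ h : Λ.s a = Λ.r b, Λ.comp a b h = c

variable {a b c a' b' c' e f : Λ.Mor}

theorem exists_isComp (h : Λ.s a = Λ.r b) : ∃ c, IsComp a b c := ⟨_, h, rfl⟩

theorem isComp_one_right (a : Λ.Mor) : IsComp a (Λ.one (Λ.s a)) a := ⟨_, Λ.comp_one a⟩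

theorem isComp_one_left (a : Λ.Mor) : IsComp (Λ.one (Λ.r a)) a a := ⟨_, Λ.one_comp a⟩

theorem isComp_head_tail (c : Λ.Mor) (m : Fin k → ℕ) (hm : m ≤ Λ.d c) :
    IsComp (Λ.head c m hm) (Λ.tail c m hm) c := ⟨s_head c m hm, head_comp_tail c m hm⟩

theorem exists_isComp_of_le {m : Fin k → ℕ} (hm : m ≤ Λ.d c) : ∃ a b, IsComp a b c ∧ Λ.d a = m :=
  ⟨_, _, isComp_head_tail c m hm, d_head c m hm⟩

namespace IsComp

theorem s_eq_r (h : IsComp a b c) : Λ.s a = Λ.r b := h.1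

theorem s_eq (h : IsComp a b c) : Λ.s c = Λ.s b := by
  obtain ⟨h, rfl⟩ := h; exact Λ.s_comp _ _ _

theorem d_eq (h : IsComp a b c) : Λ.d c = Λ.d a + Λ.d b := by
  obtain ⟨h, rfl⟩ := h; exact Λ.d_comp _ _ _

theorem d_le (h : IsComp a b c) : Λ.d a ≤ Λ.d c := h.d_eq ▸ le_self_add

theorem unique (h : IsComp a b c) (h' : IsComp a b c') : c = c' := by
  obtain ⟨h, rfl⟩ := h; exact h'.2

theorem factor_unique (h : IsComp a b c) (h' : IsComp a' b' c) (hd : Λ.d a = Λ.d a') :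
    a = a' ∧ b = b' := by
  obtain ⟨h, rfl⟩ := h
  obtain ⟨h', hc⟩ := h'
  exact TopKGraph.factor_unique h h' hc.symm hd

theorem trans (hac : IsComp a b c) (hcf : IsComp c e f) : ∃ g, IsComp b e g ∧ IsComp a g f := by
  obtain ⟨h, rfl⟩ := hac
  obtain ⟨h', rfl⟩ := hcf
  have hbe : Λ.s b = Λ.r e := by rwa [Λ.s_comp] at h'
  exact ⟨_, ⟨hbe, rfl⟩, h.trans (Λ.r_comp _ _ _).symm, (Λ.assoc _ _ _ _ _).symm⟩

end IsComp

end TopKGraph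

/-! ### Infinite paths and their initial segments -/

namespace PathSpace

open TopKGraph

/-- The relation `x = a z` between a finite path `a` and paths `z`, `x`. -/
def IsConcat (a : Λ.Mor) (z x : PathSpace Λ) : Prop := ∃ h : Λ.s a = z.r, x = concat a z h

/-- `a` is an initial segment of the path `x`. -/
def IsPrefix (a : Λ.Mor) (x : PathSpace Λ) : Prop := ∃ z, IsConcat a z x

variable {a b c a' b' : Λ.Mor} {w x y z z' : PathSpace Λ}

theorem exists_isConcat (h : Λ.s a = z.r) : ∃ x, IsConcat a z x := ⟨_, h, rfl⟩

theorem r_shift (x : PathSpace Λ) (n : Fin k → ℕ) (hn : Below n x.deg) :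
    (shift n x hn).r = x.vertex n hn :=
  congrArg x.2.obj (Subtype.ext (add_zero n))

theorem shift_congr (x : PathSpace Λ) {n n' : Fin k → ℕ} (e : n = n') (hn : Below n x.deg)
    (hn' : Below n' x.deg) : shift n x hn = shift n' x hn' := by
  subst e; rfl

theorem isConcat_seg_shift (x : PathSpace Λ) (n : Fin k → ℕ) (hn : Below n x.deg) :
    IsConcat (x.seg 0 n zero_le hn) (shift n x hn) x := by
  have h : Λ.s (x.seg 0 n zero_le hn) = (shift n x hn).r := by rw [s_path_seg, r_shift]
  exact ⟨h, (concat_shift x n hn h).symm⟩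

theorem exists_isConcat_of_below {n : Fin k → ℕ} (hn : Below n x.deg) :
    ∃ a z, IsConcat a z x ∧ Λ.d a = n :=
  ⟨_, _, isConcat_seg_shift x n hn, by rw [d_path_seg, tsub_zero]⟩

theorem isComp_seg (x : PathSpace Λ) {p q : Fin k → ℕ} (hpq : p ≤ q) (hq : Below q x.deg) :
    IsComp (x.seg 0 p zero_le (hq.mono hpq)) (x.seg p q hpq hq) (x.seg 0 q zero_le hq) :=
  ⟨_, (path_seg_comp x 0 p q zero_le hpq hq).symm⟩

namespace IsConcat

theorem s_eq_r (h : IsConcat a z x) : Λ.s a = z.r := h.1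

theorem below (h : IsConcat a z x) : Below (Λ.d a) x.deg := by
  obtain ⟨h, rfl⟩ := h; exact below_d_concat _ _ _

theorem seg_eq (h : IsConcat a z x) : x.seg 0 (Λ.d a) zero_le h.below = a := by
  obtain ⟨h, rfl⟩ := h; exact concat_seg_zero _ _ _

theorem shift_eq (h : IsConcat a z x) : shift (Λ.d a) x h.below = z := by
  obtain ⟨h, rfl⟩ := h; exact shift_concat _ _ _

theorem r_eq (h : IsConcat a z x) : Λ.r a = x.r := by
  rw [← h.seg_eq, r_path_seg]; rfl

theorem unique (h : IsConcat a z x) (h' : IsConcat a z y) : x = y := by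
  obtain ⟨_, rfl⟩ := h; obtain ⟨_, rfl⟩ := h'; rfl

theorem eq_of_d_eq (h : IsConcat a z x) (h' : IsConcat a' z' x) (hd : Λ.d a = Λ.d a') :
    a = a' ∧ z = z' := by
  constructor
  · rw [← h.seg_eq, ← h'.seg_eq]; exact seg_congr x rfl hd _ _
  · rw [← h.shift_eq, ← h'.shift_eq]; exact shift_congr x hd _ _

theorem split (h : IsConcat c z x) (hc : IsComp a b c) :
    ∃ w, IsConcat b z w ∧ IsConcat a w x := by
  have hab : Below (Λ.d a + Λ.d b) x.deg := hc.d_eq ▸ h.below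
  have ha : Below (Λ.d a) x.deg := h.below.mono hc.d_le
  have hb : Below (Λ.d b) (shift (Λ.d a) x ha).deg := below_add hab
  have hc' : IsComp (x.seg 0 (Λ.d a) zero_le ha) (x.seg (Λ.d a) (Λ.d c) hc.d_le h.below) c := by
    simpa only [h.seg_eq] using isComp_seg x hc.d_le h.below
  obtain ⟨seg_a, seg_b⟩ := hc'.factor_unique hc (by rw [d_path_seg, tsub_zero])
  have shift_seg : (shift (Λ.d a) x ha).seg 0 (Λ.d b) zero_le hb = b :=
    (seg_congr x (add_zero _) hc.d_eq.symm (add_le_add le_rfl zero_le) hab).trans seg_b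
  have shift_shift : shift (Λ.d b) (shift (Λ.d a) x ha) hb = z := by
    rw [PathSpace.shift_shift x _ _ ha hb hab, shift_congr x hc.d_eq.symm _ h.below, h.shift_eq]
  refine ⟨shift (Λ.d a) x ha, ?_, ?_⟩
  · simpa only [shift_seg, shift_shift] using isConcat_seg_shift (shift (Λ.d a) x ha) (Λ.d b) hb
  · simpa only [seg_a] using isConcat_seg_shift x (Λ.d a) ha

theorem comp (h : IsConcat a w x) (hc : IsComp a b c) (hw : IsConcat b z w) : IsConcat c z x := by
  obtain ⟨x', hx'⟩ := exists_isConcat (hc.s_eq.trans hw.s_eq_r)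
  obtain ⟨w', hw', hx⟩ := hx'.split hc
  obtain rfl := hw.unique hw'
  obtain rfl := h.unique hx
  exact hx'

theorem of_comp (h : IsConcat a w x) (hc : IsComp a b c) (h' : IsConcat c z x) :
    IsConcat b z w := by
  obtain ⟨w', hw', hx⟩ := h'.split hc
  rwa [(h.eq_of_d_eq hx rfl).2]

end IsConcat

namespace IsPrefix

theorem of_comp (h : IsPrefix c x) (hc : IsComp a b c) : IsPrefix a x := by
  obtain ⟨z, h⟩ := h
  obtain ⟨w, -, h⟩ := h.split hc
  exact ⟨w, h⟩

theorem below (h : IsPrefix a x) : Below (Λ.d a) x.deg := by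
  obtain ⟨z, h⟩ := h; exact h.below

theorem eq_of_d_eq (h : IsPrefix a x) (h' : IsPrefix a' x) (hd : Λ.d a = Λ.d a') : a = a' := by
  obtain ⟨z, h⟩ := h
  obtain ⟨z', h'⟩ := h'
  exact (h.eq_of_d_eq h' hd).1

theorem exists_isComp (h : IsPrefix a x) (h' : IsPrefix c x) (hd : Λ.d a ≤ Λ.d c) :
    ∃ b, IsComp a b c := by
  obtain ⟨a', b, hc, ha'⟩ := exists_isComp_of_le hd
  obtain rfl := (h'.of_comp hc).eq_of_d_eq h ha'
  exact ⟨b, hc⟩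

theorem join (h : IsPrefix a x) (h' : IsPrefix a' x) :
    ∃ α α' c, IsComp a α c ∧ IsComp a' α' c ∧ Λ.d c = Λ.d a ⊔ Λ.d a' ∧ IsPrefix c x := by
  obtain ⟨c, w, hc, hd⟩ := exists_isConcat_of_below (h.below.sup h'.below)
  have hcx : IsPrefix c x := ⟨w, hc⟩
  obtain ⟨α, hα⟩ := h.exists_isComp hcx (hd ▸ le_sup_left)
  obtain ⟨α', hα'⟩ := h'.exists_isComp hcx (hd ▸ le_sup_right)
  exact ⟨α, α', c, hα, hα', hd, hcx⟩

end IsPrefix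

theorem deg_le_of_isPrefix_imp (h : ∀ a, IsPrefix a x → IsPrefix a y) : x.deg ≤ y.deg := by
  intro i
  refine ENat.forall_natCast_le_iff_le.mp fun n hn => ?_
  have below_single : Below (Pi.single i n) x.deg := fun j => by
    obtain rfl | hj := eq_or_ne j i
    · simpa using hn
    · simp [Pi.single_eq_of_ne hj]
  obtain ⟨a, z, ha, hd⟩ := exists_isConcat_of_below below_single
  have := (h a ⟨z, ha⟩).below i
  rwa [hd, Pi.single_eq_same] at this

theorem ext_isPrefix (h : ∀ a, IsPrefix a x ↔ IsPrefix a y) : x = y := by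
  have seg_zero_eq : ∀ q hx hy, x.seg 0 q zero_le hx = y.seg 0 q zero_le hy :=
    fun q hx hy => ((h _).1 ⟨_, isConcat_seg_shift x q hx⟩).eq_of_d_eq
      ⟨_, isConcat_seg_shift y q hy⟩ (by rw [d_path_seg, d_path_seg])
  refine ext_seg (le_antisymm (deg_le_of_isPrefix_imp fun a => (h a).1)
    (deg_le_of_isPrefix_imp fun a => (h a).2)) fun p q hpq hx hy => ?_
  have hcy := isComp_seg y hpq hy
  rw [← seg_zero_eq q hx hy] at hcy
  exact ((isComp_seg x hpq hx).factor_unique hcy (by rw [d_path_seg, d_path_seg])).2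

/-! ### The path with prescribed initial segments -/

/-- The properties that characterize the set of initial segments of a path: it is nonempty,
contains the initial segments of its elements, and any two elements have a minimal common extension
in it. -/
structure IsPathFilter (P : Set Λ.Mor) : Prop where
  nonempty : P.Nonempty
  of_comp : ∀ {a b c}, c ∈ P → IsComp a b c → a ∈ P
  join : ∀ {a a'}, a ∈ P → a' ∈ P →
    ∃ α α', ∃ c ∈ P, IsComp a α c ∧ IsComp a' α' c ∧ Λ.d c = Λ.d a ⊔ Λ.d a'

theorem exists_le_of_natCast_le_iSup {ι : Sort*} [Nonempty ι] {f : ι → ℕ} {n : ℕ}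
    (h : (n : ℕ∞) ≤ ⨆ i, (f i : ℕ∞)) : ∃ i, n ≤ f i := by
  cases n with
  | zero => exact ⟨Classical.arbitrary ι, Nat.zero_le _⟩
  | succ n =>
    obtain ⟨i, hi⟩ := lt_iSup_iff.1
      (((Nat.cast_lt (α := ℕ∞)).2 (Nat.lt_succ_self n)).trans_le h)
    exact ⟨i, Nat.succ_le_of_lt (Nat.cast_lt.1 hi)⟩

namespace IsPathFilter

variable {P : Set Λ.Mor}

/-- The degree of the path with set of initial segments `P`. -/
noncomputable def deg (P : Set Λ.Mor) : Fin k → ℕ∞ := fun i => ⨆ a : P, (Λ.d a i : ℕ∞)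

theorem below_deg (ha : a ∈ P) : Below (Λ.d a) (deg P) := fun i =>
  le_iSup (fun a : P => (Λ.d a i : ℕ∞)) ⟨a, ha⟩

variable (hP : IsPathFilter P)
include hP

theorem eq_of_d_eq (ha : a ∈ P) (ha' : a' ∈ P) (hd : Λ.d a = Λ.d a') : a = a' := by
  obtain ⟨α, α', c, -, hα, hα', -⟩ := hP.join ha ha'
  exact (hα.factor_unique hα' hd).1

theorem exists_d_eq {n : Fin k → ℕ} (hn : Below n (deg P)) : ∃ a ∈ P, Λ.d a = n := by
  have : Nonempty P := hP.nonempty.to_subtype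
  have hdir : Directed (· ≤ ·) fun a : P => Λ.d a := fun a a' => by
    obtain ⟨α, α', c, hc, hα, hα', -⟩ := hP.join a.2 a'.2
    exact ⟨⟨c, hc⟩, hα.d_le, hα'.d_le⟩
  choose a ha using fun i => exists_le_of_natCast_le_iSup (hn i)
  obtain ⟨c, hc⟩ := hdir.finite_le a
  obtain ⟨b, e, hbe, hd⟩ := exists_isComp_of_le (c := c.1) (m := n) fun i => (ha i).trans (hc i i)
  exact ⟨b, hP.of_comp c.2 hbe, hd⟩

/-- The element of degree `n` of `P`. -/
noncomputable def initial (n : Fin k → ℕ) (hn : Below n (deg P)) : Λ.Mor :=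
  (hP.exists_d_eq hn).choose

theorem initial_mem (n : Fin k → ℕ) (hn : Below n (deg P)) : hP.initial n hn ∈ P :=
  (hP.exists_d_eq hn).choose_spec.1

theorem d_initial (n : Fin k → ℕ) (hn : Below n (deg P)) : Λ.d (hP.initial n hn) = n :=
  (hP.exists_d_eq hn).choose_spec.2

/-- The segment from `p` to `q` of the path with set of initial segments `P`. -/
noncomputable def segment (p q : Fin k → ℕ) (hpq : p ≤ q) (hq : Below q (deg P)) : Λ.Mor :=
  Λ.tail (hP.initial q hq) p (hpq.trans (hP.d_initial q hq).ge)

theorem isComp_initial_segment (p q : Fin k → ℕ) (hpq : p ≤ q) (hq : Below q (deg P)) :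
    IsComp (hP.initial p (hq.mono hpq)) (hP.segment p q hpq hq) (hP.initial q hq) := by
  have hc := isComp_head_tail (hP.initial q hq) p (hpq.trans (hP.d_initial q hq).ge)
  have head_eq := hP.eq_of_d_eq (hP.of_comp (hP.initial_mem q hq) hc)
    (hP.initial_mem p (hq.mono hpq)) (by rw [d_head, d_initial])
  rwa [head_eq] at hc

/-- The path with set of initial segments `P`. -/
noncomputable def path : PathSpace Λ :=
  ⟨deg P,
    { obj := fun p => Λ.s (hP.initial p.1 p.2)
      mor := fun f => hP.segment f.1.1 f.1.2 f.2.1 f.2.2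
      map_r := fun f => (hP.isComp_initial_segment _ _ f.2.1 f.2.2).s_eq_r.symm
      map_s := fun f => (hP.isComp_initial_segment _ _ f.2.1 f.2.2).s_eq.symm
      map_one := fun p => ((hP.isComp_initial_segment p.1 p.1 le_rfl p.2).factor_unique
        (isComp_one_right _) rfl).2
      map_comp := by
        rintro ⟨⟨p, q⟩, hpq, hq⟩ ⟨⟨q', t⟩, hqt, ht⟩ h
        obtain rfl : q = q' := congrArg Subtype.val h
        obtain ⟨g, ⟨_, rfl⟩, hg⟩ :=
          (hP.isComp_initial_segment p q hpq hq).trans (hP.isComp_initial_segment q t hqt ht)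
        exact ((hP.isComp_initial_segment p t (hpq.trans hqt) ht).factor_unique hg rfl).2
      map_d := fun f => by
        refine (d_tail _ _ _).trans ?_
        rw [d_initial]; rfl
      continuous_obj := continuous_of_discreteTopology (α := (omegaCat _).Obj)
      continuous_mor := continuous_of_discreteTopology (α := (omegaCat _).Mor) }⟩

theorem path_seg_zero (n : Fin k → ℕ) (hn : Below n (deg P)) :
    hP.path.seg 0 n zero_le hn = hP.initial n hn := by
  have hd : Λ.d (hP.initial 0 (below_zero _)) = Λ.d (Λ.one (Λ.r (hP.initial n hn))) := by
    rw [d_initial, Λ.d_one]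
  exact ((hP.isComp_initial_segment 0 n zero_le hn).factor_unique (isComp_one_left _) hd).2

theorem isPrefix_path_iff : IsPrefix a hP.path ↔ a ∈ P := by
  constructor
  · rintro ⟨z, h⟩
    rw [← h.seg_eq, path_seg_zero hP _ h.below]
    exact hP.initial_mem _ _
  · intro ha
    have hconcat := isConcat_seg_shift hP.path (Λ.d a) (below_deg ha)
    rw [path_seg_zero hP _ (below_deg ha),
      hP.eq_of_d_eq (hP.initial_mem _ _) ha (hP.d_initial _ _)] at hconcat
    exact ⟨_, hconcat⟩

end IsPathFilter

end PathSpace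

/-! ### Pairs of finite paths representing a groupoid element -/

open TopKGraph PathSpace

/-- The entry `m` of `g = (x, m, y)`, which is a cocycle on `G_Λ`. -/
def cocycle (g : (pathGroupoid Λ).Mor) : Fin k → ℤ := g.1.2.1

/-- `g = (a z, d(a) - d(b), b z)` for some path `z`. -/
def Represents (g : (pathGroupoid Λ).Mor) (a b : Λ.Mor) : Prop :=
  ∃ z, IsConcat a z ((pathGroupoid Λ).r g) ∧ IsConcat b z ((pathGroupoid Λ).s g) ∧
    ∀ i, (Λ.d a i : ℤ) - (Λ.d b i : ℤ) = cocycle g i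

section Represents

variable {g h : (pathGroupoid Λ).Mor} {a b c e α a' b' : Λ.Mor} {x y z : PathSpace Λ}

theorem exists_represents (g : (pathGroupoid Λ).Mor) : ∃ a b, Represents g a b := by
  obtain ⟨a, b, z, ha, hb, hm, hr, hs⟩ := (shiftEquiv_iff _ _ _).1 g.2
  exact ⟨a, b, z, ⟨ha, hr⟩, ⟨hb, hs⟩, hm⟩

theorem exists_represents_of_isConcat (ha : IsConcat a z x) (hb : IsConcat b z y) :
    ∃ g, (pathGroupoid Λ).r g = x ∧ (pathGroupoid Λ).s g = y ∧ Represents g a b := by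
  refine ⟨⟨(x, fun i => (Λ.d a i : ℤ) - (Λ.d b i : ℤ), y), ?_⟩, rfl, rfl, z, ha, hb, fun _ => rfl⟩
  exact (shiftEquiv_iff _ _ _).2 ⟨a, b, z, ha.1, hb.1, fun _ => rfl, ha.2, hb.2⟩

namespace Represents

theorem s_eq (hg : Represents g a b) : Λ.s a = Λ.s b := by
  obtain ⟨z, ha, hb, -⟩ := hg
  exact ha.s_eq_r.trans hb.s_eq_r.symm

theorem sub_eq (hg : Represents g a b) (i : Fin k) :
    (Λ.d a i : ℤ) - (Λ.d b i : ℤ) = cocycle g i := by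
  obtain ⟨z, -, -, hm⟩ := hg; exact hm i

theorem isPrefix_r (hg : Represents g a b) : IsPrefix a ((pathGroupoid Λ).r g) := by
  obtain ⟨z, ha, -, -⟩ := hg; exact ⟨z, ha⟩

theorem isPrefix_s (hg : Represents g a b) : IsPrefix b ((pathGroupoid Λ).s g) := by
  obtain ⟨z, -, hb, -⟩ := hg; exact ⟨z, hb⟩

theorem d_right_eq (hg : Represents g a b) (hh : Represents h a' b') (hm : cocycle g = cocycle h)
    (hd : Λ.d a = Λ.d a') : Λ.d b = Λ.d b' := by
  funext i
  have hgi := hg.sub_eq i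
  have hhi := hh.sub_eq i
  rw [hm, hd] at hgi
  omega

theorem cocycle_eq (hg : Represents g a b) (hh : Represents h a' b') (hd : Λ.d a = Λ.d a')
    (hd' : Λ.d b = Λ.d b') : cocycle g = cocycle h := by
  funext i
  rw [← hg.sub_eq, ← hh.sub_eq, hd, hd']

theorem eq_of_d_eq (hg : Represents g a b) (hg' : Represents g a' b') (hd : Λ.d a = Λ.d a') :
    a = a' ∧ b = b' :=
  ⟨hg.isPrefix_r.eq_of_d_eq hg'.isPrefix_r hd,
    hg.isPrefix_s.eq_of_d_eq hg'.isPrefix_s (hg.d_right_eq hg' rfl hd)⟩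

theorem extend (hg : Represents g a b) (hc : IsComp a α c)
    (hcr : IsPrefix c ((pathGroupoid Λ).r g)) : ∃ e, IsComp b α e ∧ Represents g c e := by
  obtain ⟨z, ha, hb, hm⟩ := hg
  obtain ⟨w, hw⟩ := hcr
  have hα : IsConcat α w z := ha.of_comp hc hw
  obtain ⟨e, he⟩ := exists_isComp (hb.s_eq_r.trans hα.r_eq.symm)
  refine ⟨e, he, w, hw, hb.comp he hα, fun i => ?_⟩
  rw [← hm i, hc.d_eq, he.d_eq]
  simp only [Pi.add_apply, Nat.cast_add]
  ring

theorem restrict (hg : Represents g c e) (hc : IsComp a α c) (he : IsComp b α e) :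
    Represents g a b := by
  obtain ⟨z, hr, hs, hm⟩ := hg
  obtain ⟨w, hα, ha⟩ := hr.split hc
  obtain ⟨w', hα', hb⟩ := hs.split he
  obtain rfl := hα.unique hα'
  refine ⟨w, ha, hb, fun i => ?_⟩
  rw [← hm i, hc.d_eq, he.d_eq]
  simp only [Pi.add_apply, Nat.cast_add]
  ring

theorem isComp_right (hg : Represents g a b) (hg' : Represents g c e) (hc : IsComp a α c) :
    IsComp b α e := by
  obtain ⟨e', he', hge'⟩ := hg.extend hc hg'.isPrefix_r
  rwa [(hg'.eq_of_d_eq hge' rfl).2]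

theorem join (hg : Represents g a b) (ha' : IsPrefix a' ((pathGroupoid Λ).r g)) :
    ∃ α α' c e, IsComp a α c ∧ IsComp a' α' c ∧ IsComp b α e ∧ Represents g c e := by
  obtain ⟨α, α', c, hα, hα', -, hc⟩ := hg.isPrefix_r.join ha'
  obtain ⟨e, he, hge⟩ := hg.extend hα hc
  exact ⟨α, α', c, e, hα, hα', he, hge⟩

theorem inv (hg : Represents g a b) : Represents ((pathGroupoid Λ).inv g) b a := by
  obtain ⟨z, ha, hb, hm⟩ := hg
  refine ⟨z, hb, ha, fun i => ?_⟩
  change _ = -cocycle g i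
  rw [← hm i, neg_sub]

theorem comp (hg : Represents g a b) (hh : Represents h b c)
    (hgh : (pathGroupoid Λ).s g = (pathGroupoid Λ).r h) :
    Represents ((pathGroupoid Λ).comp g h hgh) a c := by
  obtain ⟨z, ha, hb, hm⟩ := hg
  obtain ⟨z', hb', hc, hm'⟩ := hh
  rw [← hgh] at hb'
  obtain rfl := (hb.eq_of_d_eq hb' rfl).2
  refine ⟨z, ha, hc, fun i => ?_⟩
  change _ = cocycle g i + cocycle h i
  rw [← hm i, ← hm' i, sub_add_sub_cancel]

theorem eq_of_r_eq (hg : Represents g a b) (hh : Represents h a b)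
    (hr : (pathGroupoid Λ).r g = (pathGroupoid Λ).r h) : g = h := by
  have hm := hg.cocycle_eq hh rfl rfl
  obtain ⟨z, ha, hb, -⟩ := hg
  obtain ⟨z', ha', hb', -⟩ := hh
  rw [← hr] at ha'
  obtain rfl := (ha.eq_of_d_eq ha' rfl).2
  exact Subtype.ext (Prod.ext hr (Prod.ext hm (hb.unique hb')))

end Represents

theorem isPrefix_r_iff {a : Λ.Mor} :
    IsPrefix a ((pathGroupoid Λ).r g) ↔ ∃ α c e, IsComp a α c ∧ Represents g c e := by
  constructor
  · intro ha
    obtain ⟨a₀, b₀, hg⟩ := exists_represents g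
    obtain ⟨_, α', c, e, -, hα', -, hge⟩ := hg.join ha
    exact ⟨α', c, e, hα', hge⟩
  · rintro ⟨α, c, e, hα, hge⟩
    exact hge.isPrefix_r.of_comp hα

theorem ext_represents (hgh : ∀ a b, Represents g a b ↔ Represents h a b) : g = h := by
  obtain ⟨a, b, hg⟩ := exists_represents g
  refine hg.eq_of_r_eq ((hgh a b).1 hg) (ext_isPrefix fun c => ?_)
  simp only [isPrefix_r_iff, hgh]

theorem represents_inv_iff : Represents ((pathGroupoid Λ).inv g) b a ↔ Represents g a b := by
  refine ⟨fun h => ?_, Represents.inv⟩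
  have inv_inv : (pathGroupoid Λ).inv ((pathGroupoid Λ).inv g) = g :=
    Subtype.ext (Prod.ext rfl (Prod.ext (neg_neg _) rfl))
  simpa only [inv_inv] using h.inv

theorem represents_one_iff : Represents ((pathGroupoid Λ).one x) a b ↔ a = b ∧ IsPrefix a x := by
  constructor
  · intro h
    have hd : Λ.d a = Λ.d b := funext fun i => by
      have hi : (Λ.d a i : ℤ) - (Λ.d b i : ℤ) = 0 := h.sub_eq i
      omega
    exact ⟨h.isPrefix_r.eq_of_d_eq h.isPrefix_s hd, h.isPrefix_r⟩
  · rintro ⟨rfl, z, h⟩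
    exact ⟨z, h, h, fun i => sub_self _⟩

theorem exists_represents_represents (hgh : (pathGroupoid Λ).s g = (pathGroupoid Λ).r h) :
    ∃ a b c, Represents g a b ∧ Represents h b c := by
  obtain ⟨a₀, b₀, hg⟩ := exists_represents g
  obtain ⟨b₁, c₁, hh⟩ := exists_represents h
  have hb₁ : IsPrefix b₁ ((pathGroupoid Λ).s g) := hgh ▸ hh.isPrefix_r
  obtain ⟨α, α', b, a, -, hα', -, hba⟩ := hg.inv.join hb₁
  have hab : Represents g a b := represents_inv_iff.1 hba
  obtain ⟨c, -, hbc⟩ := hh.extend hα' (hgh ▸ hab.isPrefix_s)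
  exact ⟨a, b, c, hab, hbc⟩

end Represents

/-! ### Neighbourhoods of finite paths -/

namespace TopKGraph

variable {a b c : Λ.Mor} {U V W : Set Λ.Mor}

theorem isOpen_ofDegree (Λ : TopKGraph.{u, v} k) (m : Fin k → ℕ) : IsOpen (Λ.ofDegree m) :=
  (isOpen_discrete {m}).preimage Λ.continuous_d

theorem isClosed_ofDegree (Λ : TopKGraph.{u, v} k) (m : Fin k → ℕ) : IsClosed (Λ.ofDegree m) :=
  (isClosed_discrete {m}).preimage Λ.continuous_d

theorem ofDegree_mem_nhds (a : Λ.Mor) : Λ.ofDegree (Λ.d a) ∈ 𝓝 a :=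
  (Λ.isOpen_ofDegree _).mem_nhds rfl

theorem exists_compact_subset_ofDegree (a : Λ.Mor) :
    ∃ K ∈ 𝓝 a, IsCompact K ∧ K ⊆ Λ.ofDegree (Λ.d a) := by
  obtain ⟨K, hK, hKa⟩ := exists_compact_mem_nhds a
  exact ⟨K ∩ Λ.ofDegree (Λ.d a), inter_mem hKa (ofDegree_mem_nhds a),
    hK.inter_right (Λ.isClosed_ofDegree _), Set.inter_subset_right⟩

theorem IsComp.eventually_exists (h : IsComp a b c) (hU : U ∈ 𝓝 a) (hV : V ∈ 𝓝 b) :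
    ∀ᶠ c' in 𝓝 c, ∃ a' ∈ U, ∃ b' ∈ V, IsComp a' b' c' := by
  obtain ⟨h, rfl⟩ := h
  have hUV : {p : Λ.Composable | p.1.1 ∈ U ∧ p.1.2 ∈ V} ∈ 𝓝 (⟨(a, b), h⟩ : Λ.Composable) :=
    continuous_subtype_val.continuousAt (prod_mem_nhds hU hV)
  filter_upwards [Λ.isOpenMap_comp.image_mem_nhds hUV]
  rintro _ ⟨p, ⟨hpU, hpV⟩, rfl⟩
  exact ⟨_, hpU, _, hpV, p.2, rfl⟩

theorem IsComp.exists_nhds (h : IsComp a b c) (hW : W ∈ 𝓝 c) :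
    ∃ U ∈ 𝓝 a, ∃ V ∈ 𝓝 b, ∀ a' ∈ U, ∀ b' ∈ V, ∀ c', IsComp a' b' c' → c' ∈ W := by
  obtain ⟨h, rfl⟩ := h
  have hcomp := Λ.continuous_comp.continuousAt (x := ⟨(a, b), h⟩) hW
  obtain ⟨T, hT, hTW⟩ := (mem_nhds_subtype {p : Λ.Mor × Λ.Mor | Λ.s p.1 = Λ.r p.2} _ _).1 hcomp
  obtain ⟨U, hU, V, hV, hUV⟩ := mem_nhds_prod_iff.1 hT
  refine ⟨U, hU, V, hV, ?_⟩
  rintro a' ha' b' hb' _ ⟨h', rfl⟩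
  exact hTW (a := ⟨(a', b'), h'⟩) (hUV ⟨ha', hb'⟩)

end TopKGraph

/-! ### Neighbourhoods in the path groupoid -/

section Neighbourhoods

variable {g : (pathGroupoid Λ).Mor} {a b c e α : Λ.Mor} {U V : Set Λ.Mor}
  {F : Set (Λ.Mor × Λ.Mor)} {m : Fin k → ℤ}

theorem mem_cylinder_iff :
    g ∈ cylinder Λ F m ↔ cocycle g = m ∧ ∃ p ∈ F, Represents g p.1 p.2 := by
  constructor
  · rintro ⟨p, hp, z, ha, hb, hm, hg⟩
    have hr : (pathGroupoid Λ).r g = concat p.1 z ha := congrArg Prod.fst hg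
    have hs : (pathGroupoid Λ).s g = concat p.2 z hb := congrArg (·.2.2) hg
    have hc : cocycle g = m := congrArg (·.2.1) hg
    exact ⟨hc, p, hp, z, ⟨ha, hr⟩, ⟨hb, hs⟩, fun i => (hm i).trans (congrFun hc i).symm⟩
  · rintro ⟨rfl, p, hp, z, ⟨ha, hr⟩, ⟨hb, hs⟩, hm⟩
    exact ⟨p, hp, z, ha, hb, hm, Prod.ext hr (Prod.ext rfl hs)⟩

theorem mem_cylinder_starS_iff :
    g ∈ cylinder Λ (starS Λ U V) m ↔ cocycle g = m ∧ ∃ a ∈ U, ∃ b ∈ V, Represents g a b := by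
  rw [mem_cylinder_iff]
  refine and_congr_right fun _ => ⟨?_, ?_⟩
  · rintro ⟨p, ⟨hpU, hpV, -⟩, h⟩
    exact ⟨_, hpU, _, hpV, h⟩
  · rintro ⟨a, haU, b, hbV, h⟩
    exact ⟨(a, b), ⟨haU, hbV, h.s_eq⟩, h⟩

theorem mem_cylinder_univ (g : (pathGroupoid Λ).Mor) :
    g ∈ cylinder Λ (starS Λ Set.univ Set.univ) (cocycle g) := by
  obtain ⟨a, b, h⟩ := exists_represents g
  exact mem_cylinder_starS_iff.2 ⟨rfl, a, trivial, b, trivial, h⟩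

theorem isOpen_cylinder (hU : IsOpen U) (hV : IsOpen V) (m : Fin k → ℤ) :
    IsOpen (cylinder Λ (starS Λ U V) m) := by
  refine TopologicalSpace.isOpen_generateFrom_of_mem
    ⟨m, U, V, ∅, hU, hV, Set.empty_subset _, isCompact_empty, ?_⟩
  rw [eq_comm, Set.inter_eq_left]
  rintro g - ⟨p, hp, -⟩
  exact hp

theorem Represents.eventually_exists (h : Represents g a b) (hU : U ∈ 𝓝 a) (hV : V ∈ 𝓝 b) :
    ∀ᶠ g' in 𝓝 g, cocycle g' = cocycle g ∧ ∃ a' ∈ U, ∃ b' ∈ V, Represents g' a' b' := by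
  obtain ⟨U', hU', hUo, haU⟩ := mem_nhds_iff.1 hU
  obtain ⟨V', hV', hVo, hbV⟩ := mem_nhds_iff.1 hV
  filter_upwards [(isOpen_cylinder hUo hVo (cocycle g)).mem_nhds
    (mem_cylinder_starS_iff.2 ⟨rfl, a, haU, b, hbV, h⟩)] with g' hg'
  obtain ⟨hm, a', ha', b', hb', h'⟩ := mem_cylinder_starS_iff.1 hg'
  exact ⟨hm, a', hU' ha', b', hV' hb', h'⟩

theorem eventually_cocycle_eq (g : (pathGroupoid Λ).Mor) :
    ∀ᶠ g' in 𝓝 g, cocycle g' = cocycle g := by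
  obtain ⟨a, b, h⟩ := exists_represents g
  exact (h.eventually_exists univ_mem univ_mem).mono fun g' hg' => hg'.1

theorem isClosed_starS_univ : IsClosed (starS Λ Set.univ Set.univ) := by
  simpa only [starS, Set.mem_univ, true_and, Function.comp_apply] using
    isClosed_eq (Λ.continuous_s.comp continuous_fst) (Λ.continuous_s.comp continuous_snd)

theorem isClosed_represents (g : (pathGroupoid Λ).Mor) :
    IsClosed {p : Λ.Mor × Λ.Mor | Represents g p.1 p.2} := by
  refine isClosed_of_exists_subsingleton_inter fun p =>
    ⟨Λ.ofDegree (Λ.d p.1) ×ˢ Set.univ, prod_mem_nhds (ofDegree_mem_nhds _) univ_mem, ?_⟩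
  rintro q ⟨hq, hqd, -⟩ q' ⟨hq', hqd', -⟩
  exact Prod.ext_iff.2 (Represents.eq_of_d_eq hq hq' (Eq.trans hqd (Eq.symm hqd')))

theorem eventually_forall_not_represents (hF : IsCompact F)
    (hg : ∀ p ∈ F, ¬ Represents g p.1 p.2) :
    ∀ᶠ g' in 𝓝 g, ∀ p ∈ F, ¬ Represents g' p.1 p.2 := by
  have hopen : IsOpen (cylinder Λ (starS Λ Set.univ Set.univ) (cocycle g) ∩
      (cylinder Λ (F ∩ starS Λ Set.univ Set.univ) (cocycle g))ᶜ) :=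
    TopologicalSpace.isOpen_generateFrom_of_mem ⟨_, _, _, _, isOpen_univ, isOpen_univ,
      Set.inter_subset_right, hF.inter_right isClosed_starS_univ, rfl⟩
  have hmem : g ∉ cylinder Λ (F ∩ starS Λ Set.univ Set.univ) (cocycle g) := fun h => by
    obtain ⟨-, p, hp, hgp⟩ := mem_cylinder_iff.1 h
    exact hg p hp.1 hgp
  filter_upwards [hopen.mem_nhds ⟨mem_cylinder_univ g, hmem⟩, eventually_cocycle_eq g]
    with g' hg' hm p hp hgp
  exact hg'.2 (mem_cylinder_iff.2 ⟨hm, p, ⟨hp, trivial, trivial, hgp.s_eq⟩, hgp⟩)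

theorem exists_isOpen_restrict (hc : IsComp a α c) (he : IsComp b α e) (hU : U ∈ 𝓝 a)
    (hV : V ∈ 𝓝 b) : ∃ U' V' : Set Λ.Mor, IsOpen U' ∧ c ∈ U' ∧ IsOpen V' ∧ e ∈ V' ∧
      ∀ (g : (pathGroupoid Λ).Mor), ∀ c' ∈ U', ∀ e' ∈ V', Represents g c' e' →
        ∃ a' ∈ U, ∃ b' ∈ V, Represents g a' b' := by
  obtain ⟨A, hA, hαA, hinj⟩ := Λ.isLocalHomeomorph_s.isLocallyInjective α
  obtain ⟨U', hU', hUo, hcU⟩ := mem_nhds_iff.1 (hc.eventually_exists hU (hA.mem_nhds hαA))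
  obtain ⟨V', hV', hVo, heV⟩ := mem_nhds_iff.1 (he.eventually_exists hV (hA.mem_nhds hαA))
  refine ⟨U', V', hUo, hcU, hVo, heV, fun g c' hc' e' he' hg => ?_⟩
  obtain ⟨a', ha', α', hα', hac⟩ := hU' hc'
  obtain ⟨b', hb', β', hβ', hbe⟩ := hV' he'
  obtain rfl := hinj hα' hβ' (by rw [← hac.s_eq, ← hbe.s_eq, hg.s_eq])
  exact ⟨a', ha', b', hb', hg.restrict hac hbe⟩

end Neighbourhoods

/-! ### Limits of representing pairs and of initial segments -/

theorem TopKGraph.mem_minExt_iff {p q : Fin k → ℕ} {U V : Set Λ.Mor} {c : Λ.Mor}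
    (hU : U ⊆ Λ.ofDegree p) (hV : V ⊆ Λ.ofDegree q) :
    c ∈ Λ.minExt p q U V ↔ Λ.d c = p ⊔ q ∧ (∃ a ∈ U, ∃ α, IsComp a α c) ∧
      ∃ a' ∈ V, ∃ α', IsComp a' α' c := by
  constructor
  · rintro ⟨⟨a, ha, α, hα, hc⟩, ⟨a', ha', α', -, hc'⟩⟩
    have hd : Λ.d c = p ⊔ q := by
      rw [IsComp.d_eq hc, show Λ.d a = p from hU ha, show Λ.d α = p ⊔ q - p from hα]
      exact add_tsub_cancel_of_le le_sup_left
    exact ⟨hd, ⟨a, ha, α, hc⟩, ⟨a', ha', α', hc'⟩⟩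
  · rintro ⟨hd, ⟨a, ha, α, hc⟩, ⟨a', ha', α', hc'⟩⟩
    have hα : Λ.d α = p ⊔ q - p :=
      eq_tsub_of_add_eq (by rw [← hd, hc.d_eq, show Λ.d a = p from hU ha, add_comm])
    have hα' : Λ.d α' = p ⊔ q - q :=
      eq_tsub_of_add_eq (by rw [← hd, hc'.d_eq, show Λ.d a' = q from hV ha', add_comm])
    exact ⟨⟨a, ha, α, hα, hc⟩, ⟨a', ha', α', hα', hc'⟩⟩

section Limits

variable {ι : Type*} {l : Filter ι} {𝒰 : Ultrafilter ι} {g : ι → (pathGroupoid Λ).Mor}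
  {g₀ : (pathGroupoid Λ).Mor} {x : ι → PathSpace Λ} {x₀ : PathSpace Λ}
  {a b c e α a' b' : Λ.Mor}

/-- The pair `(a, b)` is in the lower limit along `l` of the sets of pairs representing `g i`. -/
def LimRepresents (l : Filter ι) (g : ι → (pathGroupoid Λ).Mor) (a b : Λ.Mor) : Prop :=
  (a, b) ∈ lowerLimit l fun i => {p : Λ.Mor × Λ.Mor | Represents (g i) p.1 p.2}

/-- The finite path `a` is in the lower limit along `l` of the sets of initial segments of `x i`. -/
def LimPrefix (l : Filter ι) (x : ι → PathSpace Λ) (a : Λ.Mor) : Prop :=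
  a ∈ lowerLimit l fun i => {a | IsPrefix a (x i)}

theorem limRepresents_iff : LimRepresents l g a b ↔
    ∀ U ∈ 𝓝 a, ∀ V ∈ 𝓝 b, ∀ᶠ i in l, ∃ a' ∈ U, ∃ b' ∈ V, Represents (g i) a' b' := by
  constructor
  · intro h U hU V hV
    filter_upwards [h _ (prod_mem_nhds hU hV)] with i ⟨p, hp, hpU, hpV⟩
    exact ⟨_, hpU, _, hpV, hp⟩
  · intro h W hW
    obtain ⟨U, hU, V, hV, hUV⟩ := mem_nhds_prod_iff.1 hW
    filter_upwards [h U hU V hV] with i ⟨a', ha', b', hb', hab⟩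
    exact ⟨(a', b'), hab, hUV ⟨ha', hb'⟩⟩

theorem limPrefix_iff :
    LimPrefix l x a ↔ ∀ U ∈ 𝓝 a, ∀ᶠ i in l, ∃ a' ∈ U, IsPrefix a' (x i) := by
  refine forall₂_congr fun U _ => eventually_congr (.of_forall fun i => ?_)
  exact exists_congr fun a' => and_comm

namespace LimPrefix

theorem of_comp (h : LimPrefix l x c) (hc : IsComp a b c) : LimPrefix l x a := by
  refine limPrefix_iff.2 fun U hU => ?_
  filter_upwards [limPrefix_iff.1 h _ (hc.eventually_exists hU univ_mem)] with i ⟨c', hc', hi⟩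
  obtain ⟨a', ha', b', -, hcomp⟩ := hc'
  exact ⟨a', ha', hi.of_comp hcomp⟩

theorem eq_of_d_eq [l.NeBot] (h : LimPrefix l x a) (h' : LimPrefix l x a')
    (hd : Λ.d a = Λ.d a') : a = a' :=
  lowerLimit_inter_subsingleton (Λ.isOpen_ofDegree (Λ.d a))
    (.of_forall fun _ _ hb _ hb' => hb.1.eq_of_d_eq hb'.1 (hb.2.trans hb'.2.symm))
    ⟨h, rfl⟩ ⟨h', hd.symm⟩

theorem join (hΛ : Λ.CompactlyAligned) (h : LimPrefix 𝒰 x a) (h' : LimPrefix 𝒰 x a') :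
    ∃ α α' c, IsComp a α c ∧ IsComp a' α' c ∧ Λ.d c = Λ.d a ⊔ Λ.d a' ∧ LimPrefix 𝒰 x c := by
  obtain ⟨K, hKa, hK, hKd⟩ := exists_compact_subset_ofDegree a
  obtain ⟨K', hKa', hK', hKd'⟩ := exists_compact_subset_ofDegree a'
  have hmeet : ∀ᶠ i in (𝒰 : Filter ι),
      ({c | IsPrefix c (x i)} ∩ Λ.minExt (Λ.d a) (Λ.d a') K K').Nonempty := by
    filter_upwards [limPrefix_iff.1 h K hKa, limPrefix_iff.1 h' K' hKa']
      with i ⟨b, hb, hbx⟩ ⟨b', hb', hbx'⟩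
    obtain ⟨β, β', c, hβ, hβ', hd, hc⟩ := hbx.join hbx'
    refine ⟨c, hc, (mem_minExt_iff hKd hKd').2 ⟨?_, ⟨b, hb, β, hβ⟩, ⟨b', hb', β', hβ'⟩⟩⟩
    rw [hd, show Λ.d b = Λ.d a from hKd hb, show Λ.d b' = Λ.d a' from hKd' hb']
  obtain ⟨c, hcK, hc⟩ :=
    exists_mem_lowerLimit_of_isCompact (hΛ _ _ K K' hKd hKd' hK hK') hmeet
  obtain ⟨hd, ⟨b, hb, α, hα⟩, ⟨b', hb', α', hα'⟩⟩ := (mem_minExt_iff hKd hKd').1 hcK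
  obtain rfl : b = a := (of_comp hc hα).eq_of_d_eq h (hKd hb)
  obtain rfl : b' = a' := (of_comp hc hα').eq_of_d_eq h' (hKd' hb')
  exact ⟨α, α', c, hα, hα', hd, hc⟩

end LimPrefix

theorem Represents.limRepresents (h : Represents g₀ a b) (hg : Tendsto g l (𝓝 g₀)) :
    LimRepresents l g a b :=
  limRepresents_iff.2 fun _ hU _ hV =>
    (hg.eventually (h.eventually_exists hU hV)).mono fun _ => And.right

namespace LimRepresents

theorem limPrefix (h : LimRepresents l g a b) :
    LimPrefix l (fun i => (pathGroupoid Λ).r (g i)) a := by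
  refine limPrefix_iff.2 fun U hU => ?_
  filter_upwards [limRepresents_iff.1 h U hU _ univ_mem] with i ⟨a', ha', b', _, hi⟩
  exact ⟨a', ha', hi.isPrefix_r⟩

theorem restrict (h : LimRepresents l g c e) (hc : IsComp a α c) (he : IsComp b α e) :
    LimRepresents l g a b := by
  refine limRepresents_iff.2 fun U hU V hV => ?_
  obtain ⟨U', V', hU', hcU', hV', heV', hrestrict⟩ := exists_isOpen_restrict hc he hU hV
  filter_upwards [limRepresents_iff.1 h U' (hU'.mem_nhds hcU') V' (hV'.mem_nhds heV')]
    with i ⟨c', hc', e', he', hi⟩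
  exact hrestrict (g i) c' hc' e' he' hi

variable [l.NeBot]

theorem s_eq (h : LimRepresents l g a b) : Λ.s a = Λ.s b :=
  (mem_of_mem_lowerLimit h isClosed_starS_univ
    (.of_forall fun _ _ hp => ⟨trivial, trivial, hp.s_eq⟩)).2.2

theorem eq_of_d_eq (h : LimRepresents l g a b) (h' : LimRepresents l g a' b')
    (hd : Λ.d a = Λ.d a') : a = a' ∧ b = b' :=
  Prod.ext_iff.1 <| lowerLimit_inter_subsingleton ((Λ.isOpen_ofDegree (Λ.d a)).prod isOpen_univ)
    (.of_forall fun _ _ hp _ hp' =>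
      Prod.ext_iff.2 (hp.1.eq_of_d_eq hp'.1 (hp.2.1.trans hp'.2.1.symm)))
    ⟨h, rfl, trivial⟩ ⟨h', hd.symm, trivial⟩

theorem extend (h : LimRepresents l g a b) (hc : IsComp a α c)
    (hcl : LimPrefix l (fun i => (pathGroupoid Λ).r (g i)) c) :
    ∃ e, IsComp b α e ∧ LimRepresents l g c e := by
  obtain ⟨e, he⟩ := exists_isComp (h.s_eq.symm.trans hc.s_eq_r)
  refine ⟨e, he, limRepresents_iff.2 fun U hU V hV => ?_⟩
  obtain ⟨B, hB, A, hA, hBA⟩ := he.exists_nhds hV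
  filter_upwards [limRepresents_iff.1 h _ (ofDegree_mem_nhds a) B hB, limPrefix_iff.1 hcl _
    (inter_mem hU (hc.eventually_exists (ofDegree_mem_nhds a) hA))]
    with i ⟨a₁, ha₁, b', hb', hab⟩ ⟨c', ⟨hcU, a₂, ha₂, α', hα', hcomp⟩, hci⟩
  obtain rfl : a₁ = a₂ := hab.isPrefix_r.eq_of_d_eq (hci.of_comp hcomp) (ha₁.trans ha₂.symm)
  obtain ⟨e', he', hce⟩ := hab.extend hcomp hci
  exact ⟨c', hcU, e', hBA b' hb' α' hα' e' he', hce⟩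

theorem isComp_right (h : LimRepresents l g a b) (h' : LimRepresents l g c e)
    (hc : IsComp a α c) : IsComp b α e := by
  obtain ⟨e', he', hce⟩ := h.extend hc h'.limPrefix
  rwa [(h'.eq_of_d_eq hce rfl).2]

theorem represents (h : LimRepresents l g a b) (hg : Tendsto g l (𝓝 g₀)) :
    Represents g₀ a b := by
  by_contra hab
  obtain ⟨F, hFab, hFsub, hF⟩ :=
    local_compact_nhds ((isClosed_represents g₀).isOpen_compl.mem_nhds (x := (a, b)) hab)
  obtain ⟨i, ⟨p, hp, hpF⟩, hi⟩ := ((h F hFab).and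
    (hg.eventually (eventually_forall_not_represents hF fun p hp => hFsub hp))).exists
  exact hi p hpF hp

end LimRepresents

theorem tendsto_of_represents_iff (h : ∀ a b, Represents g₀ a b ↔ LimRepresents 𝒰 g a b) :
    Tendsto g 𝒰 (𝓝 g₀) := by
  have hcocycle : ∀ᶠ i in (𝒰 : Filter ι), cocycle (g i) = cocycle g₀ := by
    obtain ⟨a, b, hab⟩ := exists_represents g₀
    filter_upwards [limRepresents_iff.1 ((h a b).1 hab) _ (ofDegree_mem_nhds a) _
      (ofDegree_mem_nhds b)] with i ⟨a', ha', b', hb', hi⟩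
    exact hi.cocycle_eq hab ha' hb'
  refine TopologicalSpace.tendsto_nhds_generateFrom_iff.2 ?_
  rintro _ ⟨m, U, V, F, hU, hV, -, hF, rfl⟩ ⟨hgUV, hgF⟩
  obtain ⟨hm, a, ha, b, hb, hab⟩ := mem_cylinder_starS_iff.1 hgUV
  have hmeet : ∀ᶠ i in (𝒰 : Filter ι), ∃ a' ∈ U, ∃ b' ∈ V, Represents (g i) a' b' :=
    limRepresents_iff.1 ((h a b).1 hab) U (hU.mem_nhds ha) V (hV.mem_nhds hb)
  have hmiss : ∀ᶠ i in (𝒰 : Filter ι), g i ∉ cylinder Λ F m := by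
    refine Ultrafilter.eventually_not.2 fun hcyl => hgF ?_
    obtain ⟨p, hpF, hp⟩ := exists_mem_lowerLimit_of_isCompact hF
      (S := fun i => {p | Represents (g i) p.1 p.2})
      (hcyl.mono fun i hi => by
        obtain ⟨-, p, hpF, hp⟩ := mem_cylinder_iff.1 hi
        exact ⟨p, hp, hpF⟩)
    exact mem_cylinder_iff.2 ⟨hm, p, hpF, (h _ _).2 hp⟩
  filter_upwards [hcocycle, hmeet, hmiss] with i hi hUV hiF
  exact ⟨mem_cylinder_starS_iff.2 ⟨hi.trans hm, hUV⟩, hiF⟩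

/-! ### Convergence of paths -/

theorem limRepresents_one_iff [l.NeBot] :
    LimRepresents l (fun i => (pathGroupoid Λ).one (x i)) a b ↔ a = b ∧ LimPrefix l x a := by
  constructor
  · intro h
    have hdiag : (a, b) ∈ Set.diagonal Λ.Mor := mem_of_mem_lowerLimit h isClosed_diagonal
      (.of_forall fun i p hp => (represents_one_iff.1 hp).1)
    exact ⟨hdiag, h.limPrefix⟩
  · rintro ⟨rfl, h⟩
    refine limRepresents_iff.2 fun U hU V hV => ?_
    filter_upwards [limPrefix_iff.1 h _ (inter_mem hU hV)] with i ⟨a', ha', hi⟩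
    exact ⟨a', ha'.1, a', ha'.2, represents_one_iff.2 ⟨rfl, hi⟩⟩

theorem limPrefix_iff_of_tendsto [l.NeBot] {x : ι → (pathGroupoid Λ).Obj}
    {x₀ : (pathGroupoid Λ).Obj} (hx : Tendsto x l (𝓝 x₀)) : LimPrefix l x a ↔ IsPrefix a x₀ := by
  have hone : Tendsto (fun i => (pathGroupoid Λ).one (x i)) l (𝓝 ((pathGroupoid Λ).one x₀)) :=
    (continuous_induced_dom.tendsto x₀).comp hx
  constructor
  · exact fun h => (represents_one_iff.1 ((limRepresents_one_iff.2 ⟨rfl, h⟩).represents hone)).2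
  · exact fun h =>
      (limRepresents_one_iff.1 ((represents_one_iff.2 ⟨rfl, h⟩).limRepresents hone)).2

theorem tendsto_of_limPrefix_iff {x : ι → (pathGroupoid Λ).Obj} {x₀ : (pathGroupoid Λ).Obj}
    (h : ∀ a, LimPrefix 𝒰 x a ↔ IsPrefix a x₀) : Tendsto x 𝒰 (𝓝 x₀) := by
  rw [nhds_induced, tendsto_comap_iff]
  refine tendsto_of_represents_iff fun a b => ?_
  exact represents_one_iff.trans
    ((and_congr_right fun _ => (h a).symm).trans limRepresents_one_iff.symm)

theorem exists_tendsto_of_limPrefix (hΛ : Λ.CompactlyAligned) {x : ι → (pathGroupoid Λ).Obj}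
    (h : LimPrefix 𝒰 x a) : ∃ x₀, Tendsto x 𝒰 (𝓝 x₀) := by
  have hP : IsPathFilter {c | LimPrefix 𝒰 x c} :=
    { nonempty := ⟨a, h⟩
      of_comp := fun hc hcomp => LimPrefix.of_comp hc hcomp
      join := fun ha ha' => by
        obtain ⟨α, α', c, hα, hα', hd, hc⟩ := LimPrefix.join hΛ ha ha'
        exact ⟨α, α', c, hc, hα, hα', hd⟩ }
  exact ⟨hP.path, tendsto_of_limPrefix_iff fun _ => hP.isPrefix_path_iff.symm⟩

/-! ### Convergence in the path groupoid -/

theorem tendsto_of_tendsto_r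
    (hr : Tendsto (fun i => (pathGroupoid Λ).r (g i)) 𝒰 (𝓝 ((pathGroupoid Λ).r g₀)))
    (h₀ : Represents g₀ a b) (h : LimRepresents 𝒰 g a b) : Tendsto g 𝒰 (𝓝 g₀) := by
  refine tendsto_of_represents_iff fun c e => ⟨fun hce => ?_, fun hce => ?_⟩
  · obtain ⟨α, α', c', e', hα, hα', he', hce'⟩ := h₀.join hce.isPrefix_r
    obtain ⟨e'', he'', hlim⟩ := h.extend hα ((limPrefix_iff_of_tendsto hr).2 hce'.isPrefix_r)
    obtain rfl := he''.unique he'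
    exact hlim.restrict hα' (hce.isComp_right hce' hα')
  · obtain ⟨α, α', c', e', hα, hα', he', hce'⟩ :=
      h₀.join ((limPrefix_iff_of_tendsto hr).1 hce.limPrefix)
    obtain ⟨e'', he'', hlim⟩ := h.extend hα ((limPrefix_iff_of_tendsto hr).2 hce'.isPrefix_r)
    obtain rfl := he''.unique he'
    exact hce'.restrict hα' (hce.isComp_right hlim hα')

theorem exists_tendsto_of_limRepresents (hΛ : Λ.CompactlyAligned) (h : LimRepresents 𝒰 g a b) :
    ∃ g₀, Tendsto g 𝒰 (𝓝 g₀) := by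
  obtain ⟨x₀, hx₀⟩ := exists_tendsto_of_limPrefix hΛ h.limPrefix
  obtain ⟨z, hz⟩ := (limPrefix_iff_of_tendsto hx₀).1 h.limPrefix
  obtain ⟨y, hy⟩ := exists_isConcat (h.s_eq.symm.trans hz.s_eq_r)
  obtain ⟨g₀, rfl, -, hg₀⟩ := exists_represents_of_isConcat hz hy
  exact ⟨g₀, tendsto_of_tendsto_r hx₀ hg₀ h⟩

end Limits

section CompactCylinders

variable {F : Set (Λ.Mor × Λ.Mor)}

theorem isCompact_cylinder (hΛ : Λ.CompactlyAligned) (hF : IsCompact F) (m : Fin k → ℤ) :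
    IsCompact (cylinder Λ F m) := by
  refine isCompact_iff_ultrafilter_le_nhds.2 fun 𝒰 h𝒰 => ?_
  have hcyl : ∀ᶠ g in (𝒰 : Filter (pathGroupoid Λ).Mor), g ∈ cylinder Λ F m :=
    le_principal_iff.1 h𝒰
  obtain ⟨p, hpF, hp⟩ := exists_mem_lowerLimit_of_isCompact hF
    (S := fun g : (pathGroupoid Λ).Mor => {p | Represents g p.1 p.2})
    (hcyl.mono fun g hg => by
      obtain ⟨-, p, hpF, hp⟩ := mem_cylinder_iff.1 hg
      exact ⟨p, hp, hpF⟩)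
  have hlim : LimRepresents 𝒰 id p.1 p.2 := hp
  obtain ⟨g₀, hg₀⟩ := exists_tendsto_of_limRepresents hΛ hlim
  obtain ⟨g, hg, hgm⟩ := (hcyl.and (hg₀.eventually (eventually_cocycle_eq g₀))).exists
  exact ⟨g₀, mem_cylinder_iff.2
    ⟨hgm.symm.trans (mem_cylinder_iff.1 hg).1, p, hpF, hlim.represents hg₀⟩, hg₀⟩

theorem t2Space_pathGroupoid (Λ : TopKGraph.{u, v} k) : T2Space (pathGroupoid Λ).Mor := by
  refine t2_iff_ultrafilter.2 fun {_ _} 𝒰 hg hg' => ext_represents fun a b => ?_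
  exact ⟨fun h => (h.limRepresents (g := id) hg).represents hg',
    fun h => (h.limRepresents (g := id) hg').represents hg⟩

theorem locallyCompactSpace_pathGroupoid (hΛ : Λ.CompactlyAligned) :
    LocallyCompactSpace (pathGroupoid Λ).Mor := by
  have := t2Space_pathGroupoid Λ
  have : WeaklyLocallyCompactSpace (pathGroupoid Λ).Mor := by
    refine ⟨fun g => ?_⟩
    obtain ⟨a, b, h⟩ := exists_represents g
    obtain ⟨K, hK, hKa⟩ := exists_compact_mem_nhds a
    obtain ⟨K', hK', hKb⟩ := exists_compact_mem_nhds b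
    refine ⟨cylinder Λ (K ×ˢ K') (cocycle g), isCompact_cylinder hΛ (hK.prod hK') _, ?_⟩
    filter_upwards [h.eventually_exists hKa hKb] with g' ⟨hm, a', ha', b', hb', h'⟩
    exact mem_cylinder_iff.2 ⟨hm, (a', b'), ⟨ha', hb'⟩, h'⟩
  infer_instance

end CompactCylinders

theorem limRepresents_iff_of_tendsto {ι : Type*} {l : Filter ι} [l.NeBot]
    {g : ι → (pathGroupoid Λ).Mor} {g₀ : (pathGroupoid Λ).Mor} {a b : Λ.Mor}
    (hg : Tendsto g l (𝓝 g₀)) : LimRepresents l g a b ↔ Represents g₀ a b :=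
  ⟨fun h => h.represents hg, fun h => h.limRepresents hg⟩

/-! ### The structure maps of the path groupoid -/

theorem continuous_inv_pathGroupoid (Λ : TopKGraph.{u, v} k) : Continuous (pathGroupoid Λ).inv := by
  refine continuous_iff_ultrafilter.2 fun g 𝒰 h𝒰 => ?_
  refine tendsto_of_represents_iff (g₀ := (pathGroupoid Λ).inv g) fun a b => ?_
  rw [represents_inv_iff, ← limRepresents_iff_of_tendsto (g := id) h𝒰, limRepresents_iff,
    limRepresents_iff]
  constructor
  · intro h U hU V hV
    filter_upwards [h V hV U hU] with g ⟨b', hb', a', ha', hg⟩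
    exact ⟨a', ha', b', hb', hg.inv⟩
  · intro h V hV U hU
    filter_upwards [h U hU V hV] with g ⟨a', ha', b', hb', hg⟩
    exact ⟨b', hb', a', ha', represents_inv_iff.1 hg⟩

theorem continuous_r_pathGroupoid (hΛ : Λ.CompactlyAligned) : Continuous (pathGroupoid Λ).r := by
  refine continuous_iff_ultrafilter.2 fun g 𝒰 h𝒰 => ?_
  have hlim {a b : Λ.Mor} : LimRepresents 𝒰 id a b ↔ Represents g a b :=
    limRepresents_iff_of_tendsto h𝒰
  obtain ⟨a₀, b₀, h₀⟩ := exists_represents g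
  refine tendsto_of_limPrefix_iff fun a => ⟨fun ha => ?_, fun ha => ?_⟩
  · obtain ⟨α, α', c, hα, hα', -, hc⟩ := (hlim.2 h₀).limPrefix.join hΛ ha
    obtain ⟨e, -, hce⟩ := (hlim.2 h₀).extend hα hc
    exact (hlim.1 hce).isPrefix_r.of_comp hα'
  · obtain ⟨α, α', c, e, -, hα', -, hce⟩ := h₀.join ha
    exact (hlim.2 hce).limPrefix.of_comp hα'

theorem continuous_s_pathGroupoid (hΛ : Λ.CompactlyAligned) : Continuous (pathGroupoid Λ).s :=
  (continuous_r_pathGroupoid hΛ).comp (continuous_inv_pathGroupoid Λ)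

theorem continuous_comp_pathGroupoid (hΛ : Λ.CompactlyAligned) :
    Continuous (pathGroupoid Λ).compMap := by
  refine continuous_iff_ultrafilter.2 fun p 𝒰 h𝒰 => ?_
  have hval : Tendsto (fun q : (pathGroupoid Λ).Composable => q.1) 𝒰 (𝓝 p.1) :=
    (continuous_subtype_val.tendsto p).mono_left h𝒰
  have hfst : Tendsto (fun q : (pathGroupoid Λ).Composable => q.1.1) 𝒰 (𝓝 p.1.1) :=
    (continuous_fst.tendsto _).comp hval
  have hsnd : Tendsto (fun q : (pathGroupoid Λ).Composable => q.1.2) 𝒰 (𝓝 p.1.2) :=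
    (continuous_snd.tendsto _).comp hval
  have hr : Tendsto (fun q : (pathGroupoid Λ).Composable => (pathGroupoid Λ).r q.1.1) 𝒰
      (𝓝 ((pathGroupoid Λ).r p.1.1)) := ((continuous_r_pathGroupoid hΛ).tendsto _).comp hfst
  obtain ⟨a, b, c, hab, hbc⟩ := exists_represents_represents p.2
  refine tendsto_of_tendsto_r hr (hab.comp hbc p.2) (limRepresents_iff.2 fun U hU W hW => ?_)
  filter_upwards [hfst.eventually (hab.eventually_exists hU (ofDegree_mem_nhds b)),
    hsnd.eventually (hbc.eventually_exists (ofDegree_mem_nhds b) hW)]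
    with q ⟨_, a', ha', b', hb', hq⟩ ⟨_, b'', hb'', c', hc', hq'⟩
  have hb : b' = b'' := hq.isPrefix_s.eq_of_d_eq (q.2 ▸ hq'.isPrefix_r) (hb'.trans hb''.symm)
  exact ⟨a', ha', c', hc', hq.comp (hb ▸ hq') q.2⟩

theorem isTopologicalGroupoid_pathGroupoid (hΛ : Λ.CompactlyAligned) :
    (pathGroupoid Λ).IsTopologicalGroupoid where
  isEmbedding_one := ⟨⟨rfl⟩, fun _ _ h => congrArg (pathGroupoid Λ).r h⟩
  continuous_r := continuous_r_pathGroupoid hΛ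
  continuous_s := continuous_s_pathGroupoid hΛ
  continuous_inv := continuous_inv_pathGroupoid Λ
  continuous_comp := continuous_comp_pathGroupoid hΛ

/-! ### The range map is a local homeomorphism -/

section RangeMap

variable {g : (pathGroupoid Λ).Mor} {a b : Λ.Mor} {U V : Set Λ.Mor}

theorem Represents.eventually_exists_r (h : Represents g a b) (hU : U ∈ 𝓝 a) (hV : V ∈ 𝓝 b) :
    ∀ᶠ x in 𝓝 ((pathGroupoid Λ).r g), ∃ g', (pathGroupoid Λ).r g' = x ∧
      ∃ a' ∈ U, ∃ b' ∈ V, Represents g' a' b' := by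
  have hsV : Λ.s ⁻¹' (Λ.s '' V) ∈ 𝓝 a := Λ.continuous_s.continuousAt
    (h.s_eq ▸ Λ.isLocalHomeomorph_s.isOpenMap.image_mem_nhds hV)
  have hprefix : LimPrefix (𝓝 ((pathGroupoid Λ).r g)) id a :=
    (limPrefix_iff_of_tendsto tendsto_id).2 h.isPrefix_r
  filter_upwards [limPrefix_iff.1 hprefix _ (inter_mem hU hsV)]
    with x ⟨a', ⟨ha', b', hb', hs⟩, z, hz⟩
  obtain ⟨y, hy⟩ := exists_isConcat (hs.trans hz.s_eq_r)
  obtain ⟨g', hr, -, hg'⟩ := exists_represents_of_isConcat hz hy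
  exact ⟨g', hr, a', ha', b', hb', hg'⟩

theorem injOn_r_of_injOn_s (hV : Set.InjOn Λ.s V) (m : Fin k → ℕ) :
    Set.InjOn (pathGroupoid Λ).r
      {g | ∃ a ∈ Λ.ofDegree m, ∃ b ∈ V, Represents g a b} := by
  rintro g ⟨a, ha, b, hb, hg⟩ g' ⟨a', ha', b', hb', hg'⟩ hr
  have haa' : a = a' := hg.isPrefix_r.eq_of_d_eq (hr ▸ hg'.isPrefix_r) (Eq.trans ha (Eq.symm ha'))
  subst haa'
  obtain rfl := hV hb hb' (hg.s_eq.symm.trans hg'.s_eq)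
  exact hg.eq_of_r_eq hg' hr

theorem isOpenMap_r_pathGroupoid (Λ : TopKGraph.{u, v} k) : IsOpenMap (pathGroupoid Λ).r := by
  refine IsOpenMap.of_nhds_le fun g₀ S hS => mem_iff_ultrafilter.2 fun 𝒰 h𝒰 => ?_
  obtain ⟨a, b, h₀⟩ := exists_represents g₀
  obtain ⟨V, hV, hbV, hinj⟩ := Λ.isLocalHomeomorph_s.isLocallyInjective b
  have : Nonempty (pathGroupoid Λ).Mor := ⟨g₀⟩
  obtain ⟨σ, hσ⟩ := ((h₀.eventually_exists_r (ofDegree_mem_nhds a)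
    (hV.mem_nhds hbV)).filter_mono h𝒰).choice
  have hlim : LimRepresents 𝒰 σ a b := by
    refine limRepresents_iff.2 fun A hA B hB => ?_
    filter_upwards [hσ, h𝒰 (h₀.eventually_exists_r (inter_mem hA (ofDegree_mem_nhds a))
      (inter_mem hB (hV.mem_nhds hbV)))]
      with x ⟨hr, hσV⟩ ⟨g, hgr, a', ⟨haA, ha'⟩, b', ⟨hbB, hbV'⟩, hg⟩
    obtain rfl : g = σ x :=
      injOn_r_of_injOn_s hinj _ ⟨a', ha', b', hbV', hg⟩ hσV (hgr.trans hr.symm)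
    exact ⟨a', haA, b', hbB, hg⟩
  have hr : Tendsto (fun x => (pathGroupoid Λ).r (σ x)) 𝒰 (𝓝 ((pathGroupoid Λ).r g₀)) :=
    (tendsto_id.mono_left h𝒰).congr' (hσ.mono fun x hx => hx.1.symm)
  filter_upwards [tendsto_of_tendsto_r hr h₀ hlim hS, hσ] with x hx hσx
  rw [← hσx.1]
  exact hx

theorem isLocalHomeomorph_r_pathGroupoid (hΛ : Λ.CompactlyAligned) :
    IsLocalHomeomorph (pathGroupoid Λ).r := by
  refine isLocalHomeomorph_iff_isOpenEmbedding_restrict.2 fun g => ?_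
  obtain ⟨a, b, h⟩ := exists_represents g
  obtain ⟨V, hV, hbV, hinj⟩ := Λ.isLocalHomeomorph_s.isLocallyInjective b
  let W := cylinder Λ (starS Λ (Λ.ofDegree (Λ.d a)) V) (cocycle g)
  have hW : IsOpen W := isOpen_cylinder (Λ.isOpen_ofDegree _) hV _
  have hgW : g ∈ W := mem_cylinder_starS_iff.2 ⟨rfl, a, rfl, b, hbV, h⟩
  have hinjW : Set.InjOn (pathGroupoid Λ).r W :=
    (injOn_r_of_injOn_s hinj (Λ.d a)).mono fun _ hg => (mem_cylinder_starS_iff.1 hg).2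
  exact ⟨W, hW.mem_nhds hgW, .of_continuous_injective_isOpenMap
    ((continuous_r_pathGroupoid hΛ).comp continuous_subtype_val)
    hinjW.injective ((isOpenMap_r_pathGroupoid Λ).domRestrict hW)⟩

end RangeMap

/-! ### The basis of the topology -/

theorem exists_cylinder_subset_inter {U₁ V₁ U₂ V₂ : Set Λ.Mor} (hU₁ : IsOpen U₁) (hV₁ : IsOpen V₁)
    (hU₂ : IsOpen U₂) (hV₂ : IsOpen V₂) {m : Fin k → ℤ} {g : (pathGroupoid Λ).Mor}
    (h₁ : g ∈ cylinder Λ (starS Λ U₁ V₁) m) (h₂ : g ∈ cylinder Λ (starS Λ U₂ V₂) m) :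
    ∃ U V : Set Λ.Mor, IsOpen U ∧ IsOpen V ∧ g ∈ cylinder Λ (starS Λ U V) m ∧
      cylinder Λ (starS Λ U V) m ⊆ cylinder Λ (starS Λ U₁ V₁) m ∩ cylinder Λ (starS Λ U₂ V₂) m := by
  obtain ⟨hm, a₁, ha₁, b₁, hb₁, hg₁⟩ := mem_cylinder_starS_iff.1 h₁
  obtain ⟨-, a₂, ha₂, b₂, hb₂, hg₂⟩ := mem_cylinder_starS_iff.1 h₂
  obtain ⟨α₁, α₂, c, e, hc₁, hc₂, he₁, hg⟩ := hg₁.join hg₂.isPrefix_r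
  have he₂ : IsComp b₂ α₂ e := hg₂.isComp_right hg hc₂
  obtain ⟨U, V, hU, hcU, hV, heV, hUV⟩ :=
    exists_isOpen_restrict hc₁ he₁ (hU₁.mem_nhds ha₁) (hV₁.mem_nhds hb₁)
  obtain ⟨U', V', hU', hcU', hV', heV', hUV'⟩ :=
    exists_isOpen_restrict hc₂ he₂ (hU₂.mem_nhds ha₂) (hV₂.mem_nhds hb₂)
  refine ⟨U ∩ U', V ∩ V', hU.inter hU', hV.inter hV',
    mem_cylinder_starS_iff.2 ⟨hm, c, ⟨hcU, hcU'⟩, e, ⟨heV, heV'⟩, hg⟩, fun g' hg' => ?_⟩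
  obtain ⟨hm', c', hc', e', he', hg'⟩ := mem_cylinder_starS_iff.1 hg'
  exact ⟨mem_cylinder_starS_iff.2 ⟨hm', hUV g' c' hc'.1 e' he'.1 hg'⟩,
    mem_cylinder_starS_iff.2 ⟨hm', hUV' g' c' hc'.2 e' he'.2 hg'⟩⟩

theorem cylinder_mono {F F' : Set (Λ.Mor × Λ.Mor)} (h : F ⊆ F') (m : Fin k → ℤ) :
    cylinder Λ F m ⊆ cylinder Λ F' m := fun _ hg =>
  let ⟨hm, p, hp, hgp⟩ := mem_cylinder_iff.1 hg
  mem_cylinder_iff.2 ⟨hm, p, h hp, hgp⟩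

theorem cylinder_union (F F' : Set (Λ.Mor × Λ.Mor)) (m : Fin k → ℤ) :
    cylinder Λ (F ∪ F') m = cylinder Λ F m ∪ cylinder Λ F' m := by
  ext g
  simp only [mem_cylinder_iff, Set.mem_union, or_and_right, exists_or, and_or_left]

theorem cylinder_empty (m : Fin k → ℤ) : cylinder Λ ∅ m = ∅ := by
  ext g
  simp only [mem_cylinder_iff, Set.mem_empty_iff_false, false_and, exists_false, and_false]

theorem isTopologicalBasis_basicSets (Λ : TopKGraph.{u, v} k) :
    TopologicalSpace.IsTopologicalBasis (basicSets Λ) where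
  exists_subset_inter := by
    rintro _ ⟨m, U₁, V₁, F₁, hU₁, hV₁, hF₁, hFc₁, rfl⟩ _
      ⟨m', U₂, V₂, F₂, hU₂, hV₂, hF₂, hFc₂, rfl⟩ g ⟨⟨hg₁, hgF₁⟩, ⟨hg₂, hgF₂⟩⟩
    obtain rfl : m = m' := (mem_cylinder_iff.1 hg₁).1.symm.trans (mem_cylinder_iff.1 hg₂).1
    obtain ⟨U, V, hU, hV, hg, hsub⟩ := exists_cylinder_subset_inter hU₁ hV₁ hU₂ hV₂ hg₁ hg₂
    refine ⟨_, ⟨m, U, V, F₁ ∪ F₂, hU, hV, Set.union_subset hF₁ hF₂, hFc₁.union hFc₂, rfl⟩, ?_⟩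
    rw [cylinder_union, Set.compl_union]
    exact ⟨⟨hg, hgF₁, hgF₂⟩, fun g' ⟨hg', hg'F₁, hg'F₂⟩ =>
      ⟨⟨(hsub hg').1, hg'F₁⟩, (hsub hg').2, hg'F₂⟩⟩
  sUnion_eq := Set.eq_univ_of_forall fun g =>
    ⟨_, ⟨cocycle g, Set.univ, Set.univ, ∅, isOpen_univ, isOpen_univ, Set.empty_subset _,
      isCompact_empty, rfl⟩, mem_cylinder_univ g, by simp [cylinder_empty]⟩
  eq_generateFrom := rfl

/-! ### Second countability -/

theorem exists_countable_isCompact_between (X : Type*) [TopologicalSpace X] [T2Space X]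
    [LocallyCompactSpace X] [SecondCountableTopology X] :
    ∃ 𝒦 : Set (Set X), 𝒦.Countable ∧ (∀ K ∈ 𝒦, IsCompact K) ∧
      ∀ F O, IsCompact F → IsOpen O → F ⊆ O → ∃ K ∈ 𝒦, F ⊆ K ∧ K ⊆ O := by
  have hB := TopologicalSpace.isBasis_countableBasis X
  let 𝒞 : Set (Set X) := {C ∈ closure '' TopologicalSpace.countableBasis X | IsCompact C}
  have h𝒞 : 𝒞.Countable :=
    ((TopologicalSpace.countable_countableBasis X).image closure).mono (Set.sep_subset _ _)
  refine ⟨Set.sUnion '' {t | t.Finite ∧ t ⊆ 𝒞}, (Set.countable_ofPred_finite_subset h𝒞).image _,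
    ?_, fun F O hF hO hFO => ?_⟩
  · rintro _ ⟨t, ⟨ht, ht𝒞⟩, rfl⟩
    exact ht.isCompact_sUnion fun C hC => (ht𝒞 hC).2
  have exists_mem_nhds : ∀ x ∈ F, ∃ C ∈ 𝒞, C ∈ 𝓝 x ∧ C ⊆ O := fun x hx => by
    obtain ⟨C, hCx, hCO, hC⟩ := local_compact_nhds (hO.mem_nhds (hFO hx))
    obtain ⟨b, hb, hxb, hbC⟩ := hB.mem_nhds_iff.1 hCx
    have hbC : closure b ⊆ C := closure_minimal hbC hC.isClosed
    exact ⟨closure b, ⟨⟨b, hb, rfl⟩, hC.of_isClosed_subset isClosed_closure hbC⟩,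
      mem_of_superset ((hB.isOpen hb).mem_nhds hxb) subset_closure, hbC.trans hCO⟩
  choose! C hC hCx hCO using exists_mem_nhds
  obtain ⟨t, htF, hFt⟩ := hF.elim_nhds_subcover C hCx
  refine ⟨⋃₀ (C '' t), ⟨_, ⟨t.finite_toSet.image C,
    Set.image_subset_iff.2 fun x hx => hC x (htF x hx)⟩, rfl⟩, ?_, ?_⟩
  · rwa [Set.sUnion_image]
  · rw [Set.sUnion_image]
    exact Set.iUnion₂_subset fun x hx => hCO x (htF x hx)

theorem secondCountableTopology_pathGroupoid (Λ : TopKGraph.{u, v} k) :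
    SecondCountableTopology (pathGroupoid Λ).Mor := by
  have hB := TopologicalSpace.isBasis_countableBasis Λ.Mor
  have hBc := TopologicalSpace.countable_countableBasis Λ.Mor
  obtain ⟨𝒦, h𝒦c, h𝒦, hbetween⟩ := exists_countable_isCompact_between (Λ.Mor × Λ.Mor)
  let I := (Set.univ : Set (Fin k → ℤ)) ×ˢ TopologicalSpace.countableBasis Λ.Mor ×ˢ
    TopologicalSpace.countableBasis Λ.Mor ×ˢ 𝒦
  let Z : (Fin k → ℤ) × Set Λ.Mor × Set Λ.Mor × Set (Λ.Mor × Λ.Mor) → Set (pathGroupoid Λ).Mor :=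
    fun ⟨m, U, V, K⟩ =>
      cylinder Λ (starS Λ U V) m ∩ (cylinder Λ (K ∩ starS Λ Set.univ Set.univ) m)ᶜ
  have hZc : (Z '' I).Countable :=
    (Set.countable_univ.prod (hBc.prod (hBc.prod h𝒦c))).image Z
  refine (TopologicalSpace.isTopologicalBasis_of_isOpen_of_nhds (s := Z '' I) ?_
    fun g W hg hW => ?_).secondCountableTopology hZc
  · rintro _ ⟨⟨m, U, V, K⟩, ⟨-, hU, hV, hK⟩, rfl⟩
    exact TopologicalSpace.isOpen_generateFrom_of_mem ⟨m, U, V, _, hB.isOpen hU, hB.isOpen hV,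
      Set.inter_subset_right, (h𝒦 K hK).inter_right isClosed_starS_univ, rfl⟩
  obtain ⟨_, ⟨m, U, V, F, hU, hV, hF, hFc, rfl⟩, ⟨hgUV, hgF⟩, hsub⟩ :=
    (isTopologicalBasis_basicSets Λ).exists_subset_of_mem_open hg hW
  obtain ⟨hm, a, ha, b, hb, hab⟩ := mem_cylinder_starS_iff.1 hgUV
  obtain ⟨U', hU', haU', hUU'⟩ := hB.exists_subset_of_mem_open ha hU
  obtain ⟨V', hV', hbV', hVV'⟩ := hB.exists_subset_of_mem_open hb hV
  obtain ⟨K, hK, hFK, hKg⟩ := hbetween F _ hFc (isClosed_represents g).isOpen_compl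
    fun p hp hgp => hgF (mem_cylinder_iff.2 ⟨hm, p, hp, hgp⟩)
  have hUV : starS Λ U' V' ⊆ starS Λ U V := fun _ hp => ⟨hUU' hp.1, hVV' hp.2.1, hp.2.2⟩
  refine ⟨Z (m, U', V', K), ⟨(m, U', V', K), ⟨trivial, hU', hV', hK⟩, rfl⟩,
    ⟨mem_cylinder_starS_iff.2 ⟨hm, a, haU', b, hbV', hab⟩, fun hgK => ?_⟩,
    fun g' ⟨hg'UV, hg'K⟩ => hsub ⟨cylinder_mono hUV m hg'UV,
      fun hg'F => hg'K (cylinder_mono (Set.subset_inter hFK hF) m hg'F)⟩⟩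
  obtain ⟨-, p, hp, hgp⟩ := mem_cylinder_iff.1 hgK
  exact hKg hp.1 hgp

end KGraph

theorem mainTheorem1 {k : ℕ} (Λ : KGraph.TopKGraph.{u, v} k) (hΛ : Λ.CompactlyAligned) :
    TopologicalSpace.IsTopologicalBasis (KGraph.basicSets Λ) ∧
    SecondCountableTopology (KGraph.pathGroupoid Λ).Mor ∧
    T2Space (KGraph.pathGroupoid Λ).Mor ∧
    LocallyCompactSpace (KGraph.pathGroupoid Λ).Mor ∧
    (KGraph.pathGroupoid Λ).IsTopologicalGroupoid ∧
    (KGraph.pathGroupoid Λ).IsRDiscrete ∧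
    ∃ ν : (KGraph.pathGroupoid Λ).Obj → MeasureTheory.Measure (KGraph.pathGroupoid Λ).Mor,
      (KGraph.pathGroupoid Λ).IsHaarSystem ν ∧
      ∀ x, ν x = MeasureTheory.Measure.count.restrict ((KGraph.pathGroupoid Λ).rFiber x) := by
  have hr := KGraph.isLocalHomeomorph_r_pathGroupoid hΛ
  have hG := KGraph.isTopologicalGroupoid_pathGroupoid hΛ
  have := KGraph.secondCountableTopology_pathGroupoid Λ
  have := KGraph.t2Space_pathGroupoid Λ
  have := KGraph.locallyCompactSpace_pathGroupoid hΛ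
  exact ⟨KGraph.isTopologicalBasis_basicSets Λ, ‹_›, ‹_›, ‹_›, hG,
    hG.isRDiscrete hr.isLocallyInjective, _, hG.isHaarSystem_count_restrict hr, fun _ => rfl⟩
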